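/- **Setting.** Let $G$ be a Lie group and $N,H\le G$ closed subgroups with $N$ normal and abelian such that $N\times H\to G$, $(n,h)\mapsto nh$, is a diffeomorphism ($G=N\ltimes H$). Let $\nu\colon N\to\mathbb T$ be a (smooth) unitary character, $G_\nu=\{x\in G:\nu(x^{-1}nx)=\nu(n)\ \forall n\in N\}$, $H_\nu=H\cap G_\nu$, and give $H/H_\nu$ its quotient manifold structure. Let $\mathcal K_\Phi$ be a finite-dimensional complex Hilbert space, $\mathcal H_\sigma\le\mathcal K_\Phi$ a subspace with the inherited inner product $\langle\cdot,\cdot\rangle_\sigma$, $\sigma\colon H_\nu\to U(\mathcal H_\sigma)$ a unitary representation and $\Phi\colon H\to GL(\mathcal K_\Phi)$ a smooth representation that extends it, $\Phi(k)v=\sigma(k)v$ for $k\in H_\nu$, $v\in\mathcal H_\sigma$. Let $L\colon H/H_\nu\to H$ be a smooth global section of $H\to H/H_\nu$, put $W_L(h,q)=L(hq)^{-1}hL(q)\in H_\nu$, and let $\mu$ be an $H$-invariant Borel measure on $H/H_\nu$ that is finite on compact sets. A *Hermitian $G$-bundle* over a manifold $M$ with a smooth $G$-action $l$ is a smooth complex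 vector bundle $E\to M$ with a smooth Hermitian metric and a smooth $G$-action $\lambda$ on $E$ covering $l$ by fiberwise linear isometries; if $\mu$ is a $G$-invariant measure on $M$, its *associated induced representation* is $U(g)\psi=\lambda(g)\circ\psi\circ l_g^{-1}$ on the space $L^2(M,E;\mu)$ of square-integrable Borel sections modulo null sections. $\mathrm{Ind}_{G_\nu}^G\nu\sigma$ is left translation, $f\mapsto f(x^{-1}\,\cdot\,)$, on the Borel functions $f\colon G\to\mathcal H_\sigma$ with $f(gs)=(\nu\sigma)(s)^{-1}f(g)$ for $s\in G_\nu$ and $\int_{G/G_\nu}\|f\|^2d\mu<\infty$, modulo null functions, where $(\nu\sigma)(nk)=\nu(n)\sigma(k)$ for $n\in N$, $k\in H_\nu$ and $\mu$ is transported by $H/H_\nu\cong G/G_\nu$, $hH_\nu\mapsto hG_\nu$. $G$ acts on $H/H_\nu$ by $nh\cdot yH_\nu=hyH_\nu$. **Theorem.** The following are well-defined Hermitian $G$-bundles over $H/H_\nu$. * The boosting bundle $E_{L,\sigma}=H/H_\nu\times\mathcal H_\sigma$, with metric $h_L((q,v),(q,w))=\langle v,w\rangle_\sigma$ and action $\lambda_L(nh)(yH_\nu,v)=\bigl(hyH_\nu,\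 \nu((hy)^{-1}nhy)\,\sigma(W_L(h,yH_\nu))v\bigr)$. * The perception bundle $E_\sigma=R_\sigma$, the range of $A\colon H/H_\nu\times\mathcal H_\sigma\to H/H_\nu\times\mathcal K_\Phi$, $A(q,w)=(q,\Phi(L(q))w)$, a smooth subbundle of $H/H_\nu\times\mathcal K_\Phi$, with metric $h((xH_\nu,v),(xH_\nu,w))=\langle v,\Phi(x)^{\dagger-1}\Phi(x)^{-1}w\rangle$ (for every representative $x$) and action $\lambda(nh)(yH_\nu,v)=\bigl(hyH_\nu,\ \nu((hy)^{-1}nhy)\,\Phi(h)v\bigr)$. The map $A\colon E_{L,\sigma}\to E_\sigma$ is an isomorphism of Hermitian $G$-bundles. The associated induced representations $U$ of $E_\sigma$ and $U_L$ of $E_{L,\sigma}$, and $\mathrm{Ind}_{G_\nu}^G\nu\sigma$, are strongly continuous unitary representations on Hilbert spaces and $$\mathrm{Ind}_{G_\nu}^G\nu\sigma\cong U\cong U_L;$$ $\psi\mapsto A\circ\psi$ is a unitary operator from the space of $U_L$ onto that of $U$ which intertwines $U_L$ and $U$, and the space of $U_L$ is $L^2(H/H_\nu;\mu)\otimes\mathcal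 H_\sigma$, where $f\otimes v$ corresponds to the section $q\mapsto f(q)v$. -/

import Mathlib

open MeasureTheory Set Function
open scoped Manifold ContDiff TensorProduct ComplexConjugate

noncomputable section

namespace Perception

/-! ## Unitary representations -/

section UnitaryRep

variable {G 𝓗 𝓗' : Type*} [Group G]
  [NormedAddCommGroup 𝓗] [InnerProductSpace ℂ 𝓗] [NormedAddCommGroup 𝓗'] [InnerProductSpace ℂ 𝓗']

/-- A homomorphism into the unitary group is a unitary representation: the space is a Hilbert space
and the homomorphism is strongly continuous. -/
def IsUnitaryRepresentation [TopologicalSpace G] (ρ : G →* (𝓗 ≃ₗᵢ[ℂ] 𝓗)) : Prop :=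
  CompleteSpace 𝓗 ∧ ∀ v : 𝓗, Continuous fun g => ρ g v

/-- The unitary operator `T` intertwines the two representations. -/
def Intertwines (ρ : G →* (𝓗 ≃ₗᵢ[ℂ] 𝓗)) (ρ' : G →* (𝓗' ≃ₗᵢ[ℂ] 𝓗')) (T : 𝓗 ≃ₗᵢ[ℂ] 𝓗') : Prop :=
  ∀ (g : G) (v : 𝓗), T (ρ g v) = ρ' g (T v)

/-- Unitary equivalence of representations. -/
def UnitarilyEquivalent (ρ : G →* (𝓗 ≃ₗᵢ[ℂ] 𝓗)) (ρ' : G →* (𝓗' ≃ₗᵢ[ℂ] 𝓗')) : Prop :=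
  ∃ T : 𝓗 ≃ₗᵢ[ℂ] 𝓗', Intertwines ρ ρ' T

end UnitaryRep

/-! ## The `L²` space of a vector space of functions with a pointwise inner product

Both the Hilbert space of square-integrable Borel sections of an Hermitian bundle and the Hilbert
space of an induced representation are of the following form: there is a vector space `𝓑` of Borel
functions, and for each point `x` of a measure space `M` a positive semidefinite form on `𝓑` (the
inner product of the values at `x`). The Hilbert space is
`{f ∈ 𝓑 | ∫ ⟨f, f⟩_x dμ(x) < ∞}` modulo the functions with `∫ ⟨f, f⟩_x dμ(x) = 0`. -/

/-- A measurable family of positive semidefinite Hermitian forms, indexed by `M`, on `𝓑`. -/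
structure FormField (M : Type*) [MeasurableSpace M] (𝓑 : Type*) [AddCommGroup 𝓑] [Module ℂ 𝓑] where
  core : M → PreInnerProductSpace.Core ℂ 𝓑
  measurable_form : ∀ f g : 𝓑, Measurable fun x => (core x).inner f g

namespace FormField

variable {M : Type*} [MeasurableSpace M] {𝓑 : Type*} [AddCommGroup 𝓑] [Module ℂ 𝓑]
  (D : FormField M 𝓑) (μ : Measure M)

/-- The value of the form at `x`; conjugate linear in the first variable. -/
def form (x : M) (f g : 𝓑) : ℂ := (D.core x).inner f g

variable {D} in
theorem measurable_form' (f g : 𝓑) : Measurable fun x => D.form x f g := D.measurable_form f g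

theorem form_add_left (x : M) (f g k : 𝓑) :
    D.form x (f + g) k = D.form x f k + D.form x g k := (D.core x).add_left f g k

theorem form_smul_left (x : M) (c : ℂ) (f g : 𝓑) :
    D.form x (c • f) g = conj c * D.form x f g := (D.core x).smul_left f g c

theorem form_conj (x : M) (f g : 𝓑) : conj (D.form x g f) = D.form x f g :=
  (D.core x).conj_inner_symm f g

theorem form_nonneg (x : M) (f : 𝓑) : 0 ≤ (D.form x f f).re := (D.core x).re_inner_nonneg f

theorem form_add_right (x : M) (f g k : 𝓑) :
    D.form x f (g + k) = D.form x f g + D.form x f k := by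
  rw [← D.form_conj, form_add_left, map_add, D.form_conj, D.form_conj]

theorem form_smul_right (x : M) (c : ℂ) (f g : 𝓑) :
    D.form x f (c • g) = c * D.form x f g := by
  rw [← D.form_conj, form_smul_left, map_mul, D.form_conj, Complex.conj_conj]

theorem norm_form_le (x : M) (f g : 𝓑) :
    ‖D.form x f g‖ ≤ (D.form x f f).re + (D.form x g g).re := by
  have h := @InnerProductSpace.Core.inner_mul_inner_self_le ℂ 𝓑 _ _ _ (D.core x) f g
  change ‖D.form x f g‖ * ‖D.form x g f‖ ≤ (D.form x f f).re * (D.form x g g).re at h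
  have h' : ‖D.form x g f‖ = ‖D.form x f g‖ := by
    rw [← D.form_conj x f g, RCLike.norm_conj]
  rw [h'] at h
  have := D.form_nonneg x f
  have := D.form_nonneg x g
  nlinarith [norm_nonneg (D.form x f g)]

/-- The condition `∫ ⟨f, f⟩_x dμ(x) < ∞`. -/
def SqIntegrable (f : 𝓑) : Prop := ∫⁻ x, ENNReal.ofReal (D.form x f f).re ∂μ < ⊤

variable {D μ} in
theorem SqIntegrable.integrable_re {f : 𝓑} (hf : D.SqIntegrable μ f) :
    Integrable (fun x => (D.form x f f).re) μ := by
  refine ⟨(Complex.measurable_re.comp (measurable_form' f f)).aestronglyMeasurable, ?_⟩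
  rw [hasFiniteIntegral_iff_ofReal (Filter.Eventually.of_forall fun x => D.form_nonneg x f)]
  exact hf

variable {D μ} in
theorem SqIntegrable.integrable {f g : 𝓑} (hf : D.SqIntegrable μ f) (hg : D.SqIntegrable μ g) :
    Integrable (fun x => D.form x f g) μ :=
  (hf.integrable_re.add hg.integrable_re).mono' (measurable_form' f g).aestronglyMeasurable
    (Filter.Eventually.of_forall fun x => D.norm_form_le x f g)

theorem sqIntegrable_of_integrable {f : 𝓑} (h : Integrable (fun x => D.form x f f) μ) :
    D.SqIntegrable μ f := by
  have h1 : HasFiniteIntegral (fun x => (D.form x f f).re) μ := h.re.2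
  rw [hasFiniteIntegral_iff_ofReal (Filter.Eventually.of_forall fun x => D.form_nonneg x f)] at h1
  exact h1

/-- The subspace of square-integrable elements. -/
def sqIntegrable : Submodule ℂ 𝓑 where
  carrier := {f | D.SqIntegrable μ f}
  zero_mem' := by
    have : ∀ x, D.form x 0 0 = 0 := fun x => by
      simpa using D.form_smul_left x 0 0 0
    simp [SqIntegrable, this]
  add_mem' {f g} hf hg := by
    apply D.sqIntegrable_of_integrable μ
    have : (fun x => D.form x (f + g) (f + g)) = fun x =>
        (D.form x f f + D.form x f g) + (D.form x g f + D.form x g g) := by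
      funext x
      rw [form_add_left, form_add_right, form_add_right]
    rw [this]
    exact ((SqIntegrable.integrable hf hf).add (SqIntegrable.integrable hf hg)).add
      ((SqIntegrable.integrable hg hf).add (SqIntegrable.integrable hg hg))
  smul_mem' c f hf := by
    apply D.sqIntegrable_of_integrable μ
    have : (fun x => D.form x (c • f) (c • f)) = fun x => conj c * (c * D.form x f f) := by
      funext x
      rw [form_smul_left, form_smul_right]
    rw [this]
    exact ((SqIntegrable.integrable hf hf).const_mul c).const_mul _

/-- The square-integrable elements, as a type that carries the seminorm of the `L²` form. -/
def PreL2 : Type _ := ↥(D.sqIntegrable μ)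

instance : AddCommGroup (D.PreL2 μ) := inferInstanceAs (AddCommGroup ↥(D.sqIntegrable μ))
instance : Module ℂ (D.PreL2 μ) := inferInstanceAs (Module ℂ ↥(D.sqIntegrable μ))

variable {D μ} in
/-- The underlying element of `𝓑`. -/
def PreL2.val (f : D.PreL2 μ) : 𝓑 := Subtype.val f

variable {D μ} in
theorem PreL2.property (f : D.PreL2 μ) : D.SqIntegrable μ f.val := Subtype.property f

variable {D μ} in
@[ext] theorem PreL2.ext {f g : D.PreL2 μ} (h : f.val = g.val) : f = g := Subtype.ext h

/-- The `L²` form `⟨f, g⟩ = ∫ ⟨f, g⟩_x dμ(x)`. -/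
@[reducible]
def preL2Core : PreInnerProductSpace.Core ℂ (D.PreL2 μ) where
  inner f g := ∫ x, D.form x f.val g.val ∂μ
  conj_inner_symm f g := by
    rw [← integral_conj]
    simp only [D.form_conj]
  re_inner_nonneg f := by
    have h := f.property.integrable f.property
    rw [show RCLike.re (∫ x, D.form x f.val f.val ∂μ) = ∫ x, (D.form x f.val f.val).re ∂μ from
      (integral_re h).symm]
    exact integral_nonneg fun x => D.form_nonneg x _
  add_left f g k := by
    rw [← integral_add (f.property.integrable k.property) (g.property.integrable k.property)]
    exact integral_congr_ae (Filter.Eventually.of_forall fun x => D.form_add_left x _ _ _)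
  smul_left f g c := by
    rw [← integral_const_mul]
    exact integral_congr_ae (Filter.Eventually.of_forall fun x => D.form_smul_left x _ _ _)

instance : SeminormedAddCommGroup (D.PreL2 μ) :=
  @InnerProductSpace.Core.toSeminormedAddCommGroup ℂ _ _ _ _ (D.preL2Core μ)

instance : InnerProductSpace ℂ (D.PreL2 μ) := InnerProductSpace.ofCore (D.preL2Core μ)

theorem PreL2.inner_def (f g : D.PreL2 μ) : inner ℂ f g = ∫ x, D.form x f.val g.val ∂μ := rfl

/-- The `L²` space: `PreL2` modulo the elements of seminorm zero. -/
abbrev L2 : Type _ := SeparationQuotient (D.PreL2 μ)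

section Action

variable {G : Type*} [Group G] (ρ : G →* Module.End ℂ 𝓑) (l : G →* Equiv.Perm M)

variable {D μ ρ l} in
theorem form_translate (h : ∀ g x f f', D.form (l g x) (ρ g f) (ρ g f') = D.form x f f')
    (g : G) (x : M) (f f' : 𝓑) :
    D.form x (ρ g f) (ρ g f') = D.form (l g⁻¹ x) f f' := by
  rw [← h g (l g⁻¹ x)]
  simp

variable {D μ ρ l} in
theorem integral_translate (hl : ∀ g, MeasurePreserving (l g) μ μ)
    (h : ∀ g x f f', D.form (l g x) (ρ g f) (ρ g f') = D.form x f f') (g : G) (f f' : 𝓑) :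
    ∫ x, D.form x (ρ g f) (ρ g f') ∂μ = ∫ x, D.form x f f' ∂μ := by
  simp only [form_translate h]
  conv_rhs => rw [← (hl g⁻¹).map_eq]
  rw [integral_map (hl g⁻¹).measurable.aemeasurable (measurable_form' f f').aestronglyMeasurable]

variable {D μ ρ l} in
theorem SqIntegrable.translate (hl : ∀ g, MeasurePreserving (l g) μ μ)
    (h : ∀ g x f f', D.form (l g x) (ρ g f) (ρ g f') = D.form x f f') (g : G) {f : 𝓑}
    (hf : D.SqIntegrable μ f) : D.SqIntegrable μ (ρ g f) := by
  unfold SqIntegrable at *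
  simp only [form_translate h]
  rw [← (hl g⁻¹).map_eq, lintegral_map _ (hl g⁻¹).measurable] at hf
  · exact hf
  · exact (Complex.measurable_re.comp (measurable_form' f f)).ennreal_ofReal

variable {D μ ρ l} in
/-- The operator of translation by `g` on `PreL2`. -/
def preTranslate (hl : ∀ g, MeasurePreserving (l g) μ μ)
    (h : ∀ g x f f', D.form (l g x) (ρ g f) (ρ g f') = D.form x f f') (g : G) :
    D.PreL2 μ →ₗᵢ[ℂ] D.PreL2 μ where
  toFun f := ⟨ρ g f.val, f.property.translate hl h g⟩
  map_add' f f' := PreL2.ext ((ρ g).map_add f.val f'.val)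
  map_smul' c f := PreL2.ext ((ρ g).map_smul c f.val)
  norm_map' f := by
    rw [@norm_eq_sqrt_re_inner ℂ, @norm_eq_sqrt_re_inner ℂ _ _ _ _ f]
    congr 2
    exact integral_translate hl h g f.val f.val

variable {D μ ρ l} in
/-- The operator of translation by `g` on `L2`. -/
def translate (hl : ∀ g, MeasurePreserving (l g) μ μ)
    (h : ∀ g x f f', D.form (l g x) (ρ g f) (ρ g f') = D.form x f f') (g : G) :
    D.L2 μ →ₗ[ℂ] D.L2 μ where
  toFun := SeparationQuotient.lift (fun f => SeparationQuotient.mk (preTranslate hl h g f))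
    fun _ _ hff' => SeparationQuotient.mk_eq_mk.2 (hff'.map (preTranslate hl h g).continuous)
  map_add' := by
    rintro ⟨f⟩ ⟨f'⟩
    exact congrArg SeparationQuotient.mk ((preTranslate hl h g).map_add f f')
  map_smul' c := by
    rintro ⟨f⟩
    exact congrArg SeparationQuotient.mk ((preTranslate hl h g).map_smul c f)

variable {D μ ρ l} in
/-- The unitary representation of `G` on `L2` that comes from an action `ρ` of `G` on `𝓑` by
operators which preserve the forms and cover a measure-preserving action `l` on `M`. -/
def unitaryRep (hl : ∀ g, MeasurePreserving (l g) μ μ)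
    (h : ∀ g x f f', D.form (l g x) (ρ g f) (ρ g f') = D.form x f f') :
    G →* (D.L2 μ ≃ₗᵢ[ℂ] D.L2 μ) :=
  have key : ∀ (g g' : G) (f : D.L2 μ),
      translate hl h (g * g') f = translate hl h g (translate hl h g' f) := by
    rintro g g' ⟨f⟩
    exact congrArg SeparationQuotient.mk (PreL2.ext (by
      change ρ (g * g') f.val = ρ g (ρ g' f.val)
      simp))
  have key1 : ∀ f : D.L2 μ, translate hl h 1 f = f := by
    rintro ⟨f⟩
    exact congrArg SeparationQuotient.mk (PreL2.ext (by
      change ρ 1 f.val = f.val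
      simp))
  { toFun := fun g =>
      { toLinearEquiv := LinearEquiv.ofLinearMap (translate hl h g) (translate hl h g⁻¹)
          (by ext f; simp [← key, key1]) (by ext f; simp [← key, key1])
        norm_map' := by
          rintro ⟨f⟩
          exact (preTranslate hl h g).norm_map f }
    map_one' := by
      ext f
      exact key1 f
    map_mul' := fun g g' => by
      ext f
      exact key g g' f }

end Action

end FormField

/-! ## Induced representations -/

section Induced

variable {G : Type*} [Group G] [MeasurableSpace G] (S : Subgroup G)
  {V : Type*} [NormedAddCommGroup V] [InnerProductSpace ℂ V] [FiniteDimensional ℂ V]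
  [MeasurableSpace V] [BorelSpace V] (σ : S →* (V ≃ₗᵢ[ℂ] V))

theorem secondCountable_of_finiteDimensional (V : Type*) [NormedAddCommGroup V] [NormedSpace ℂ V]
    [FiniteDimensional ℂ V] : SecondCountableTopology V :=
  haveI := FiniteDimensional.proper ℂ V
  inferInstance

/-- The Borel functions `f : G → V` with `f (g s) = σ(s)⁻¹ f(g)`. -/
def equivariantFunctions : Submodule ℂ (G → V) where
  carrier := {f | Measurable f ∧ ∀ (g : G) (s : S), f (g * s) = (σ s)⁻¹ (f g)}
  zero_mem' := ⟨measurable_const, fun g s => by simp⟩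
  add_mem' {f f'} hf hf' := by
    have := secondCountable_of_finiteDimensional V
    exact ⟨hf.1.add hf'.1, fun g s => by simp [hf.2, hf'.2]⟩
  smul_mem' c f hf := ⟨hf.1.const_smul c, fun g s => by simp [hf.2]⟩

theorem inner_equivariant (f f' : equivariantFunctions S σ) (g : G) (s : S) :
    inner ℂ (f.1 (g * s)) (f'.1 (g * s)) = inner ℂ (f.1 g) (f'.1 g) := by
  rw [f.2.2, f'.2.2, LinearIsometryEquiv.inner_map_map]

theorem inner_out (f f' : equivariantFunctions S σ) (g : G) :
    inner ℂ (f.1 (g : G ⧸ S).out) (f'.1 (g : G ⧸ S).out) = inner ℂ (f.1 g) (f'.1 g) := by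
  obtain ⟨s, hs⟩ := QuotientGroup.mk_out_eq_mul S g
  rw [hs, inner_equivariant]

/-- At `gS ∈ G/S`, the form `⟨f(g), f'(g)⟩`, which is independent of the representative `g`. -/
def inducedField : FormField (G ⧸ S) (equivariantFunctions S σ) where
  core q :=
    { inner := fun f f' => inner ℂ (f.1 q.out) (f'.1 q.out)
      conj_inner_symm := fun f f' => inner_conj_symm _ _
      re_inner_nonneg := fun f => inner_self_nonneg
      add_left := fun f f' k => inner_add_left _ _ _
      smul_left := fun f f' c => inner_smul_left _ _ _ }
  measurable_form f f' := by
    have := secondCountable_of_finiteDimensional V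
    refine QuotientGroup.measurable_from_quotient.2 ?_
    have : ((fun q : G ⧸ S => inner ℂ (f.1 q.out) (f'.1 q.out)) ∘ ((↑) : G → G ⧸ S)) =
        fun g => inner ℂ (f.1 g) (f'.1 g) := funext fun g => inner_out S σ f f' g
    exact this ▸ f.2.1.inner f'.2.1

theorem inducedField_form_mk (f f' : equivariantFunctions S σ) (g : G) :
    (inducedField S σ).form (g : G ⧸ S) f f' = inner ℂ (f.1 g) (f'.1 g) := inner_out S σ f f' g

variable [MeasurableMul G]

/-- Left translation `(x · f)(y) = f(x⁻¹ y)`. -/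
def leftTranslation : G →* Module.End ℂ (equivariantFunctions S σ) where
  toFun x :=
    { toFun := fun f => ⟨fun y => f.1 (x⁻¹ * y), f.2.1.comp (measurable_const_mul _),
        fun g s => by
          change f.1 (x⁻¹ * (g * s)) = _
          rw [← mul_assoc]
          exact f.2.2 _ s⟩
      map_add' := fun f f' => rfl
      map_smul' := fun c f => rfl }
  map_one' := by ext f y; simp
  map_mul' x x' := by ext f y; simp [mul_assoc]

theorem leftTranslation_form (g : G) (q : G ⧸ S) (f f' : equivariantFunctions S σ) :
    (inducedField S σ).form (MulAction.toPermHom G (G ⧸ S) g q)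
      (leftTranslation S σ g f) (leftTranslation S σ g f') = (inducedField S σ).form q f f' := by
  obtain ⟨y, rfl⟩ := QuotientGroup.mk_surjective q
  change (inducedField S σ).form ((g * y : G) : G ⧸ S) _ _ = _
  rw [inducedField_form_mk, inducedField_form_mk]
  simp [leftTranslation]

/-- The representation `Ind_S^G σ`, with respect to a `G`-invariant measure on `G/S`. -/
def Ind (μ : Measure (G ⧸ S)) (hμ : ∀ g, MeasurePreserving (MulAction.toPermHom G (G ⧸ S) g) μ μ) :
    G →* ((inducedField S σ).L2 μ ≃ₗᵢ[ℂ] (inducedField S σ).L2 μ) :=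
  FormField.unitaryRep hμ (leftTranslation_form S σ)

end Induced

/-! ## Hermitian `G`-bundles -/

section Bundle

/-- The family `F` of subspaces of `K` is a smooth subbundle of rank `r` of the product bundle
`M × K`: near each point there is a smooth local frame of `r` sections. -/
def IsSmoothSubbundle (EM : Type*) {M K : Type*} [NormedAddCommGroup EM] [NormedSpace ℝ EM]
    [TopologicalSpace M] [ChartedSpace EM M] [NormedAddCommGroup K] [NormedSpace ℂ K]
    (r : ℕ) (F : M → Submodule ℂ K) : Prop :=
  ∀ x₀ : M, ∃ U : Set M, IsOpen U ∧ x₀ ∈ U ∧ ∃ s : Fin r → M → K,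
    (∀ i, ContMDiffOn 𝓘(ℝ, EM) 𝓘(ℝ, K) ∞ (s i) U) ∧
    ∀ x ∈ U, LinearIndependent ℂ (fun i => s i x) ∧ Submodule.span ℂ (range fun i => s i x) = F x

/-- The total space `{(x, v) | v ∈ F x}`. -/
def totalSpace {M K : Type*} [NormedAddCommGroup K] [NormedSpace ℂ K] (F : M → Submodule ℂ K) :
    Set (M × K) :=
  {p | p.2 ∈ F p.1}

/-- An Hermitian `G`-bundle over the manifold `M`, on which the Lie group `G` acts by `l`, whose
underlying vector bundle is a smooth subbundle of a product bundle `M × K`. The metric and the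
action are given by functions on all of `K` and `M × K`, of which only the restrictions to the
fibers and to the total space matter. The metric is conjugate linear in the first variable.
Smoothness on the total space, an embedded submanifold of `M × K`, is smoothness on this subset. -/
structure HermitianGBundle (EG EM : Type*) {G M : Type*} [Group G] [TopologicalSpace G]
    [NormedAddCommGroup EG] [NormedSpace ℝ EG] [ChartedSpace EG G]
    [TopologicalSpace M] [NormedAddCommGroup EM] [NormedSpace ℝ EM] [ChartedSpace EM M]
    (l : G →* Equiv.Perm M) (K : Type*) [NormedAddCommGroup K] [NormedSpace ℂ K] where
  rank : ℕ
  fiber : M → Submodule ℂ K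
  isSubbundle : IsSmoothSubbundle EM rank fiber
  metric : M → K → K → ℂ
  metric_add_left : ∀ x, ∀ u ∈ fiber x, ∀ v ∈ fiber x, ∀ w ∈ fiber x,
    metric x (u + v) w = metric x u w + metric x v w
  metric_smul_left : ∀ x, ∀ c : ℂ, ∀ u ∈ fiber x, ∀ v ∈ fiber x,
    metric x (c • u) v = conj c * metric x u v
  metric_conj : ∀ x, ∀ u ∈ fiber x, ∀ v ∈ fiber x, conj (metric x v u) = metric x u v
  metric_pos : ∀ x, ∀ u ∈ fiber x, u ≠ 0 → 0 < (metric x u u).re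
  smooth_metric : ContMDiffOn (𝓘(ℝ, EM).prod (𝓘(ℝ, K).prod 𝓘(ℝ, K))) 𝓘(ℝ, ℂ) ∞
    (fun p : M × (K × K) => metric p.1 p.2.1 p.2.2)
    {p | p.2.1 ∈ fiber p.1 ∧ p.2.2 ∈ fiber p.1}
  smooth_base : ContMDiff (𝓘(ℝ, EG).prod 𝓘(ℝ, EM)) 𝓘(ℝ, EM) ∞ fun q : G × M => l q.1 q.2
  act : G → M × K → M × K
  act_fst : ∀ g, ∀ p ∈ totalSpace fiber, (act g p).1 = l g p.1
  act_mem : ∀ g, ∀ p ∈ totalSpace fiber, act g p ∈ totalSpace fiber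
  act_one : ∀ p ∈ totalSpace fiber, act 1 p = p
  act_mul : ∀ g g', ∀ p ∈ totalSpace fiber, act (g * g') p = act g (act g' p)
  act_add : ∀ g x, ∀ u ∈ fiber x, ∀ v ∈ fiber x,
    (act g (x, u + v)).2 = (act g (x, u)).2 + (act g (x, v)).2
  act_smul : ∀ g x, ∀ c : ℂ, ∀ u ∈ fiber x, (act g (x, c • u)).2 = c • (act g (x, u)).2
  act_isometry : ∀ g x, ∀ u ∈ fiber x, ∀ v ∈ fiber x,
    metric (l g x) (act g (x, u)).2 (act g (x, v)).2 = metric x u v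
  smooth_act : ContMDiffOn (𝓘(ℝ, EG).prod (𝓘(ℝ, EM).prod 𝓘(ℝ, K))) (𝓘(ℝ, EM).prod 𝓘(ℝ, K)) ∞
    (fun q : G × (M × K) => act q.1 q.2) (univ ×ˢ totalSpace fiber)

namespace HermitianGBundle

variable {EG EM : Type*} {G M : Type*} [Group G] [TopologicalSpace G]
    [NormedAddCommGroup EG] [NormedSpace ℝ EG] [ChartedSpace EG G]
    [TopologicalSpace M] [NormedAddCommGroup EM] [NormedSpace ℝ EM] [ChartedSpace EM M]
    {l : G →* Equiv.Perm M}
    {K : Type*} [NormedAddCommGroup K] [NormedSpace ℂ K]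
    {K' : Type*} [NormedAddCommGroup K'] [NormedSpace ℂ K']

/-- The total space of the bundle. -/
def total (E : HermitianGBundle EG EM l K) : Set (M × K) := totalSpace E.fiber

/-- `A` restricts to an Hermitian `G`-bundle homomorphism over `M`: a smooth map of total spaces
over the identity of `M` that is linear and isometric on the fibers and `G`-equivariant. -/
structure IsHom (E : HermitianGBundle EG EM l K) (E' : HermitianGBundle EG EM l K')
    (A : M × K → M × K') : Prop where
  mapsTo : MapsTo A E.total E'.total
  map_base : ∀ p ∈ E.total, (A p).1 = p.1
  map_add : ∀ x, ∀ u ∈ E.fiber x, ∀ v ∈ E.fiber x,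
    (A (x, u + v)).2 = (A (x, u)).2 + (A (x, v)).2
  map_smul : ∀ x, ∀ c : ℂ, ∀ u ∈ E.fiber x, (A (x, c • u)).2 = c • (A (x, u)).2
  isometry : ∀ x, ∀ u ∈ E.fiber x, ∀ v ∈ E.fiber x,
    E'.metric x (A (x, u)).2 (A (x, v)).2 = E.metric x u v
  equivariant : ∀ g, ∀ p ∈ E.total, A (E.act g p) = E'.act g (A p)
  smooth : ContMDiffOn (𝓘(ℝ, EM).prod 𝓘(ℝ, K)) (𝓘(ℝ, EM).prod 𝓘(ℝ, K')) ∞ A E.total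

/-- `A` restricts to an Hermitian `G`-bundle isomorphism. -/
def IsIso (E : HermitianGBundle EG EM l K) (E' : HermitianGBundle EG EM l K')
    (A : M × K → M × K') : Prop :=
  E.IsHom E' A ∧ ∃ B : M × K' → M × K, E'.IsHom E B ∧ InvOn B A E.total E'.total

/-! ### Square-integrable sections -/

variable [FiniteDimensional ℂ K] [MeasurableSpace K] [BorelSpace K]
  [MeasurableSpace M] [OpensMeasurableSpace M]

/-- The space of Borel sections. -/
def borelSections (E : HermitianGBundle EG EM l K) : Submodule ℂ (M → K) where
  carrier := {ψ | Measurable ψ ∧ ∀ x, ψ x ∈ E.fiber x}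
  zero_mem' := ⟨measurable_const, fun x => zero_mem _⟩
  add_mem' {f f'} hf hf' := by
    have := secondCountable_of_finiteDimensional K
    exact ⟨hf.1.add hf'.1, fun x => add_mem (hf.2 x) (hf'.2 x)⟩
  smul_mem' c f hf := ⟨hf.1.const_smul c, fun x => Submodule.smul_mem _ c (hf.2 x)⟩

theorem measurable_comp_of_continuousOn {X Y Z : Type*} [MeasurableSpace X]
    [TopologicalSpace Y] [MeasurableSpace Y] [OpensMeasurableSpace Y]
    [TopologicalSpace Z] [MeasurableSpace Z] [BorelSpace Z] {f : Y → Z} {s : Set Y}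
    (hf : ContinuousOn f s) {g : X → Y} (hg : Measurable g) (hgs : ∀ x, g x ∈ s) :
    Measurable fun x => f (g x) :=
  (continuousOn_iff_continuous_domRestrict.1 hf).measurable.comp (hg.subtype_mk (h := hgs))

/-- The form field of an Hermitian bundle, `h_x(ψ(x), φ(x))`. -/
def formField (E : HermitianGBundle EG EM l K) : FormField M E.borelSections where
  core x :=
    { inner := fun ψ φ => E.metric x (ψ.1 x) (φ.1 x)
      conj_inner_symm := fun ψ φ => E.metric_conj x _ (ψ.2.2 x) _ (φ.2.2 x)
      re_inner_nonneg := fun ψ => by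
        change 0 ≤ (E.metric x (ψ.1 x) (ψ.1 x)).re
        by_cases h : ψ.1 x = 0
        · have := E.metric_smul_left x 0 0 (zero_mem _) 0 (zero_mem _)
          simp only [smul_zero, map_zero, zero_mul] at this
          rw [h, this]
          simp
        · exact (E.metric_pos x _ (ψ.2.2 x) h).le
      add_left := fun ψ φ χ => E.metric_add_left x _ (ψ.2.2 x) _ (φ.2.2 x) _ (χ.2.2 x)
      smul_left := fun ψ φ c => E.metric_smul_left x c _ (ψ.2.2 x) _ (φ.2.2 x) }
  measurable_form ψ φ := by
    have := secondCountable_of_finiteDimensional K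
    exact measurable_comp_of_continuousOn E.smooth_metric.continuousOn
      (measurable_id.prodMk (ψ.2.1.prodMk φ.2.1)) fun x => ⟨ψ.2.2 x, φ.2.2 x⟩

/-- The square-integrable Borel sections. -/
abbrev PreL2 (E : HermitianGBundle EG EM l K) (μ : Measure M) : Type _ := E.formField.PreL2 μ

/-- The Hilbert space `L²(M, E; μ, h)`. -/
abbrev L2 (E : HermitianGBundle EG EM l K) (μ : Measure M) : Type _ := E.formField.L2 μ

/-- The section underlying a square-integrable section. -/
def sec {E : HermitianGBundle EG EM l K} {μ : Measure M} (ψ : E.PreL2 μ) : M → K := ψ.val.1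

/-- The class of a square-integrable section. -/
def cls {E : HermitianGBundle EG EM l K} {μ : Measure M} (ψ : E.PreL2 μ) : E.L2 μ :=
  SeparationQuotient.mk ψ

/-- The operator `ψ ↦ λ(g) ∘ ψ ∘ (l_g)⁻¹` on Borel sections. -/
def sectionAction (E : HermitianGBundle EG EM l K) (hl : ∀ g, Measurable (l g)) :
    G →* Module.End ℂ E.borelSections where
  toFun g :=
    { toFun := fun ψ => ⟨fun x => (E.act g (l g⁻¹ x, ψ.1 (l g⁻¹ x))).2, by
        have := secondCountable_of_finiteDimensional K
        have hc : ContinuousOn (fun p => (E.act g p).2) (totalSpace E.fiber) := by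
          have h1 : ContinuousOn (fun p : M × K => ((g, p) : G × (M × K))) (totalSpace E.fiber) :=
            (continuous_const.prodMk continuous_id).continuousOn
          exact continuous_snd.comp_continuousOn
            (E.smooth_act.continuousOn.comp h1 fun p hp => ⟨mem_univ _, hp⟩)
        exact measurable_comp_of_continuousOn hc
          ((hl g⁻¹).prodMk (ψ.2.1.comp (hl g⁻¹))) fun x => ψ.2.2 _, fun x => by
        have hp : ((l g⁻¹ x, ψ.1 (l g⁻¹ x)) : M × K) ∈ totalSpace E.fiber := ψ.2.2 _
        have h1 := E.act_mem g _ hp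
        have h2 := E.act_fst g _ hp
        have h3 : l g (l g⁻¹ x) = x := by simp
        simp only [h3] at h2
        simpa only [totalSpace, mem_ofPred_eq, h2] using h1⟩
      map_add' := fun ψ φ => Subtype.ext (funext fun x =>
        E.act_add g _ _ (ψ.2.2 _) _ (φ.2.2 _))
      map_smul' := fun c ψ => Subtype.ext (funext fun x => E.act_smul g _ c _ (ψ.2.2 _)) }
  map_one' := by
    ext ψ x
    have := E.act_one (x, ψ.1 x) (ψ.2.2 x)
    simp [this]
  map_mul' g g' := by
    ext ψ x
    have hp : ((l g'⁻¹ (l g⁻¹ x), ψ.1 (l g'⁻¹ (l g⁻¹ x))) : M × K) ∈ totalSpace E.fiber := ψ.2.2 _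
    have h2 := E.act_fst g' _ hp
    have h3 : l g' (l g'⁻¹ (l g⁻¹ x)) = l g⁻¹ x := by simp
    simp only [h3] at h2
    simp only [mul_inv_rev, map_mul, Equiv.Perm.coe_mul, Function.comp_apply, Module.End.mul_apply,
      LinearMap.coe_mk, AddHom.coe_mk]
    rw [E.act_mul g g' _ hp]
    congr 2
    exact Prod.ext h2 rfl

/-- The induced representation associated with an Hermitian `G`-bundle and a `G`-invariant measure
on its base, `U(g) ψ = λ(g) ∘ ψ ∘ (l_g)⁻¹`. -/
def inducedRep (E : HermitianGBundle EG EM l K) (μ : Measure M)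
    (hμ : ∀ g, MeasurePreserving (l g) μ μ) : G →* (E.L2 μ ≃ₗᵢ[ℂ] E.L2 μ) :=
  FormField.unitaryRep (ρ := E.sectionAction fun g => (hμ g).measurable) hμ fun g x ψ φ => by
    change E.metric (l g x) (E.act g (l g⁻¹ (l g x), ψ.1 (l g⁻¹ (l g x)))).2
      (E.act g (l g⁻¹ (l g x), φ.1 (l g⁻¹ (l g x)))).2 = E.metric x (ψ.1 x) (φ.1 x)
    have h3 : l g⁻¹ (l g x) = x := by simp
    rw [h3]
    exact E.act_isometry g x _ (ψ.2.2 x) _ (φ.2.2 x)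

end HermitianGBundle

end Bundle

/-! ## Semidirect products -/

section Semidirect

variable {G : Type*} [Group G]

theorem semidirect_eq {N H : Subgroup G} (e : N × H ≃ G) (he : ∀ n h, e (n, h) = (n : G) * h) (g : G) : g = ((e.symm g).1 : G) * (e.symm g).2 := by
  rw [← he, e.apply_symm_apply]

theorem symm_mul {N H : Subgroup G} (e : N × H ≃ G) (he : ∀ n h, e (n, h) = (n : G) * h)
    (n : N) (h : H) : e.symm ((n : G) * h) = (n, h) := by
  rw [← he, e.symm_apply_apply]

variable (N H : Subgroup G) [N.Normal]

/-- `x⁻¹ n x` as an element of the normal subgroup `N`. -/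
def conjInv (x : G) (n : N) : N :=
  ⟨x⁻¹ * n * x, by simpa using Subgroup.Normal.conj_mem inferInstance n.1 n.2 x⁻¹⟩

theorem conjInv_mul (x : G) (n n' : N) : conjInv N x (n * n') = conjInv N x n * conjInv N x n' :=
  Subtype.ext (by simp [conjInv]; group)

theorem conjInv_conjInv (x y : G) (n : N) :
    conjInv N y (conjInv N x n) = conjInv N (x * y) n :=
  Subtype.ext (by simp [conjInv]; group)

variable {N H} in
/-- The projection homomorphism `G = N ⋉ H → H`, `nh ↦ h`. -/
def projH (e : N × H ≃ G) (he : ∀ n h, e (n, h) = (n : G) * h) : G →* H where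
  toFun g := (e.symm g).2
  map_one' := by
    have := symm_mul e he 1 1
    simp only [Subgroup.coe_one, mul_one] at this
    rw [this]
  map_mul' g g' := by
    have h : g * g' = (((e.symm g).1 * conjInv N ((e.symm g).2 : G)⁻¹ (e.symm g').1 : N) : G) *
        ((e.symm g).2 * (e.symm g').2 : H) := by
      conv_lhs => rw [semidirect_eq e he g, semidirect_eq e he g']
      simp [conjInv, mul_assoc]
    conv_lhs => rw [h, symm_mul e he]

variable {N H} in
theorem symm_fst_mul (e : N × H ≃ G) (he : ∀ n h, e (n, h) = (n : G) * h)
    (g g' : G) :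
    (e.symm (g * g')).1 = (e.symm g).1 * conjInv N ((e.symm g).2 : G)⁻¹ (e.symm g').1 := by
  have h : g * g' = (((e.symm g).1 * conjInv N ((e.symm g).2 : G)⁻¹ (e.symm g').1 : N) : G) *
      ((e.symm g).2 * (e.symm g').2 : H) := by
    conv_lhs => rw [semidirect_eq e he g, semidirect_eq e he g']
    simp [conjInv, mul_assoc]
  rw [h, symm_mul e he]

variable [TopologicalSpace G] (ν : PontryaginDual N)

/-- The isotropy group `G_ν` of `ν` for the action `(x · ν)(n) = ν(x⁻¹ n x)`. -/
def isotropy : Subgroup G where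
  carrier := {x | ∀ n, ν (conjInv N x n) = ν n}
  one_mem' n := by
    congr 1
    exact Subtype.ext (by simp [conjInv])
  mul_mem' {x y} hx hy n := by
    rw [← conjInv_conjInv, hy, hx]
  inv_mem' {x} hx n := by
    rw [← hx, conjInv_conjInv]
    congr 1
    exact Subtype.ext (by simp [conjInv])

/-- The little group `H_ν = H ∩ G_ν`, as a subgroup of `H`. -/
def littleGroup : Subgroup H := (isotropy N ν).subgroupOf H

/-- The map `H/H_ν → G/G_ν`, `h H_ν ↦ h G_ν`. -/
def iota : H ⧸ littleGroup N H ν → G ⧸ isotropy N ν :=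
  Quotient.map' (fun h : H => (h : G)) fun a b hab => by
    rw [QuotientGroup.leftRel_apply] at hab ⊢
    exact hab

variable {N H} in
theorem iota_mk (h : H) : iota N H ν (h : H ⧸ littleGroup N H ν) = ((h : G) : G ⧸ isotropy N ν) :=
  rfl

variable {N H}

/-- The action of `G = N ⋉ H` on `H/H_ν`, `nh · y H_ν = h y H_ν`. -/
def baseAction (e : N × H ≃ G) (he : ∀ n h, e (n, h) = (n : G) * h) :
    G →* Equiv.Perm (H ⧸ littleGroup N H ν) :=
  (MulAction.toPermHom H (H ⧸ littleGroup N H ν)).comp (projH e he)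

variable [IsMulCommutative N]

theorem le_isotropy : N ≤ isotropy N ν := fun x hx n => by
  congr 1
  refine Subtype.ext ?_
  have : (⟨x, hx⟩ : N) * n = n * ⟨x, hx⟩ := mul_comm' _ _
  have h2 : x * (n : G) = n * x := congrArg Subtype.val this
  simp [conjInv, mul_assoc, ← h2]

theorem projH_mem (e : N × H ≃ G) (he : ∀ n h, e (n, h) = (n : G) * h)
    {g : G} (hg : g ∈ isotropy N ν) : (e.symm g).2 ∈ littleGroup N H ν := by
  change ((e.symm g).2 : G) ∈ isotropy N ν
  have h : ((e.symm g).2 : G) = ((e.symm g).1 : G)⁻¹ * g := by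
    conv_rhs => rw [semidirect_eq e he g]
    simp [symm_mul e he]
  rw [h]
  exact mul_mem (inv_mem (le_isotropy ν (e.symm g).1.2)) hg

/-- Multiplication by a complex number of modulus one, as a unitary operator. -/
def phase (V : Type*) [NormedAddCommGroup V] [InnerProductSpace ℂ V] : Circle →* (V ≃ₗᵢ[ℂ] V) where
  toFun z :=
    { toLinearEquiv := LinearEquiv.smulOfNeZero ℂ V (z : ℂ) z.coe_ne_zero
      norm_map' := fun v => by
        change ‖(z : ℂ) • v‖ = ‖v‖
        rw [norm_smul, Circle.norm_coe, one_mul] }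
  map_one' := by
    ext v
    change ((1 : Circle) : ℂ) • v = v
    simp
  map_mul' z w := by
    ext v
    change ((z * w : Circle) : ℂ) • v = (z : ℂ) • (w : ℂ) • v
    rw [Circle.coe_mul, mul_smul]

/-- The representation `νσ` of `G_ν = N ⋉ H_ν`, `νσ(nh) = ν(n) σ(h)`. -/
def nuSigma (e : N × H ≃ G) (he : ∀ n h, e (n, h) = (n : G) * h)
    {V : Type*} [NormedAddCommGroup V] [InnerProductSpace ℂ V]
    (σ : littleGroup N H ν →* (V ≃ₗᵢ[ℂ] V)) : isotropy N ν →* (V ≃ₗᵢ[ℂ] V) where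
  toFun g := phase V (ν (e.symm (g : G)).1) * σ ⟨(e.symm (g : G)).2, projH_mem ν e he g.2⟩
  map_one' := by
    have := symm_mul e he 1 1
    simp only [Subgroup.coe_one, mul_one] at this
    simp only [Subgroup.coe_one, this, map_one, one_mul]
    exact map_one σ
  map_mul' g g' := by
    have h1 : ν (e.symm ((g * g' : isotropy N ν) : G)).1 =
        ν (e.symm (g : G)).1 * ν (e.symm (g' : G)).1 := by
      rw [Subgroup.coe_mul, symm_fst_mul e he, map_mul]
      congr 1
      exact (inv_mem (projH_mem ν e he g.2) : ((e.symm (g : G)).2)⁻¹ ∈ littleGroup N H ν) _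
    have h2 : (⟨(e.symm ((g * g' : isotropy N ν) : G)).2, projH_mem ν e he (g * g').2⟩ :
        littleGroup N H ν) = ⟨(e.symm (g : G)).2, projH_mem ν e he g.2⟩ *
          ⟨(e.symm (g' : G)).2, projH_mem ν e he g'.2⟩ :=
      Subtype.ext ((projH e he).map_mul g g')
    rw [h1, h2, map_mul, map_mul]
    ext v
    simp [phase]

end Semidirect

/-! ## Invariant measures -/

section Measure

theorem measurePreserving_quotient {G : Type*} [Group G] [MeasurableSpace G] [MeasurableMul G]
    (S : Subgroup G) (μ : Measure (G ⧸ S)) [SMulInvariantMeasure G (G ⧸ S) μ] (g : G) :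
    MeasurePreserving (MulAction.toPermHom G (G ⧸ S) g) μ μ := by
  have h : Measurable fun q : G ⧸ S => g • q :=
    QuotientGroup.measurable_from_quotient.2
      (QuotientGroup.measurable_coe.comp (measurable_const_mul g))
  refine ⟨h, Measure.ext fun s hs => ?_⟩
  change Measure.map (fun q : G ⧸ S => g • q) μ s = μ s
  rw [Measure.map_apply h hs]
  exact SMulInvariantMeasure.measure_preimage_smul g hs

/-- Open sets of `G/S` are measurable. -/
instance opensMeasurableSpace_quotient {G : Type*} [Group G] [TopologicalSpace G]
    [MeasurableSpace G] [OpensMeasurableSpace G] (S : Subgroup G) :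
    OpensMeasurableSpace (G ⧸ S) :=
  ⟨MeasurableSpace.generateFrom_le fun s (hs : IsOpen s) =>
    (hs.preimage QuotientGroup.continuous_mk).measurableSet⟩

variable {G : Type*} [Group G] [TopologicalSpace G] [MeasurableSpace G]
  {N H : Subgroup G} [N.Normal] (ν : PontryaginDual N)

theorem measurable_iota : Measurable (iota N H ν) :=
  QuotientGroup.measurable_from_quotient.2
    (QuotientGroup.measurable_coe.comp measurable_subtype_coe)

/-- An `H`-invariant measure on `H/H_ν` is invariant for the action of `G = N ⋉ H`. -/
theorem measurePreserving_baseAction [MeasurableMul H] (e : N × H ≃ G)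
    (he : ∀ n h, e (n, h) = (n : G) * h) (μ : Measure (H ⧸ littleGroup N H ν))
    [SMulInvariantMeasure H (H ⧸ littleGroup N H ν) μ] (g : G) :
    MeasurePreserving (baseAction ν e he g) μ μ :=
  measurePreserving_quotient _ μ (projH e he g)

theorem iota_baseAction [IsMulCommutative N] (e : N × H ≃ G)
    (he : ∀ n h, e (n, h) = (n : G) * h) (g : G) (q : H ⧸ littleGroup N H ν) :
    iota N H ν (baseAction ν e he g q) = g • iota N H ν q := by
  obtain ⟨y, rfl⟩ := QuotientGroup.mk_surjective q
  change (((projH e he g * y : H) : G) : G ⧸ isotropy N ν) = ((g * (y : G) : G) : G ⧸ isotropy N ν)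
  rw [QuotientGroup.eq]
  have h : ((projH e he g * y : H) : G)⁻¹ * (g * y) =
      (conjInv N ((projH e he g * y : H) : G) (e.symm g).1 : G) := by
    have h0 : g = ((e.symm g).1 : G) * (projH e he g : G) := semidirect_eq e he g
    have h1 : g * (y : G) = ((e.symm g).1 : G) * ((projH e he g : G) * y) := by
      rw [← mul_assoc, ← h0]
    rw [h1]
    simp [conjInv, mul_assoc]
  rw [h]
  exact le_isotropy ν (Subtype.property _)

/-- The image on `G/G_ν` of an `H`-invariant measure on `H/H_ν` is `G`-invariant. -/
theorem measurePreserving_map_iota [IsMulCommutative N] [MeasurableMul G] [MeasurableMul H]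
    (e : N × H ≃ G) (he : ∀ n h, e (n, h) = (n : G) * h) (μ : Measure (H ⧸ littleGroup N H ν))
    [SMulInvariantMeasure H (H ⧸ littleGroup N H ν) μ] (g : G) :
    MeasurePreserving (MulAction.toPermHom G (G ⧸ isotropy N ν) g)
      (μ.map (iota N H ν)) (μ.map (iota N H ν)) := by
  have h : Measurable fun q : G ⧸ isotropy N ν => g • q :=
    QuotientGroup.measurable_from_quotient.2
      (QuotientGroup.measurable_coe.comp (measurable_const_mul g))
  have hb := measurePreserving_baseAction ν e he μ g
  refine ⟨h, ?_⟩
  change Measure.map (fun q : G ⧸ isotropy N ν => g • q) _ = _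
  rw [Measure.map_map h (measurable_iota ν)]
  conv_rhs => rw [← hb.map_eq, Measure.map_map (measurable_iota ν) hb.measurable]
  congr 1
  funext q
  exact (iota_baseAction ν e he g q).symm

end Measure

/-! ## The Wigner transformation -/

section Wigner

variable {H : Type*} [Group H] {S : Subgroup H} (L : H ⧸ S → H)
  (hL : ∀ q, ((L q : H) : H ⧸ S) = q)

/-- The Wigner transformation `W_L(x, q) = L(x q)⁻¹ x L(q)`, an element of `S`. -/
def wigner (x : H) (q : H ⧸ S) : S :=
  ⟨(L (x • q))⁻¹ * x * L q, by
    rw [mul_assoc, ← QuotientGroup.eq, hL]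
    conv_lhs => rw [← hL q]
    rfl⟩

end Wigner

end Perception

end

/-!
The elements `L(gq)⁻¹ g L(q)` of `G_ν` form a smooth cocycle over `H ⧸ H_ν`, the cocycle of the
section `L`, and the boosting bundle is the product bundle on which `G` acts through the values of
`νσ` on it. Its Hermitian `G`-bundle axioms are therefore instances of facts on unitary cocycles,
and the perception bundle inherits its own by transport along `Φ(L(q))`.

The fiber of the perception bundle over the base coset `q₀` is `𝓗_σ`, with isotropy action `νσ`, so
that `ψ ↦ (g ↦ g⁻¹ • ψ(g • q₀))` identifies its sections with the equivariant functions on `G` and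
`U` with the induced representation. The space of `U_L` is the space of square-integrable functions
with values in `𝓗_σ`. There strong continuity holds because continuous sections with compact
support are dense and the action moves them continuously; it passes to the other two
representations through the unitary equivalences.
-/

noncomputable section

namespace Perception

section UnitaryEquivalence

variable {G 𝓗 𝓗' : Type*} [Group G]
  [NormedAddCommGroup 𝓗] [InnerProductSpace ℂ 𝓗] [NormedAddCommGroup 𝓗'] [InnerProductSpace ℂ 𝓗']
  {ρ : G →* (𝓗 ≃ₗᵢ[ℂ] 𝓗)} {ρ' : G →* (𝓗' ≃ₗᵢ[ℂ] 𝓗')}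

theorem Intertwines.symm {T : 𝓗 ≃ₗᵢ[ℂ] 𝓗'} (h : Intertwines ρ ρ' T) :
    Intertwines ρ' ρ T.symm := fun g v => by
  rw [LinearIsometryEquiv.symm_apply_eq, h, T.apply_symm_apply]

theorem UnitarilyEquivalent.symm (h : UnitarilyEquivalent ρ ρ') : UnitarilyEquivalent ρ' ρ :=
  let ⟨T, hT⟩ := h
  ⟨T.symm, hT.symm⟩

theorem UnitarilyEquivalent.isUnitaryRepresentation [TopologicalSpace G]
    (h : UnitarilyEquivalent ρ ρ') (hρ : IsUnitaryRepresentation ρ) :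
    IsUnitaryRepresentation ρ' := by
  obtain ⟨T, hT⟩ := h
  refine ⟨(completeSpace_congr (e := T.toEquiv)
    T.isometry.isUniformInducing.isUniformEmbedding).1 hρ.1, fun v => ?_⟩
  have h_conj : ∀ g, ρ' g v = T (ρ g (T.symm v)) := fun g => by rw [hT, T.apply_symm_apply]
  simp only [h_conj]
  exact T.continuous.comp (hρ.2 _)

end UnitaryEquivalence

section StrongContinuity

variable {G 𝓗 : Type*} [Group G] [TopologicalSpace G]
  [NormedAddCommGroup 𝓗] [InnerProductSpace ℂ 𝓗] {ρ : G →* (𝓗 ≃ₗᵢ[ℂ] 𝓗)}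

theorem continuous_orbit_of_continuousAt_one [ContinuousMul G] {v : 𝓗}
    (h : ContinuousAt (fun g => ρ g v) 1) : Continuous fun g => ρ g v := by
  refine continuous_iff_continuousAt.2 fun g₀ => ?_
  have h_translate : (fun g => ρ g v) = fun g => ρ g₀ (ρ (g₀⁻¹ * g) v) := funext fun g => by
    rw [← Function.comp_apply (f := ρ g₀), ← LinearIsometryEquiv.coe_mul, ← map_mul,
      mul_inv_cancel_left]
  rw [h_translate]
  refine (ρ g₀).continuous.continuousAt.comp
    (ContinuousAt.comp (f := fun g => g₀⁻¹ * g) (g := fun g => ρ g v) ?_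
      (continuous_const_mul _).continuousAt)
  rwa [inv_mul_cancel]

theorem continuousAt_one_orbit_of_dense {s : Set 𝓗} (hs : Dense s)
    (h : ∀ v ∈ s, ContinuousAt (fun g => ρ g v) 1) (v : 𝓗) :
    ContinuousAt (fun g => ρ g v) 1 := by
  rw [Metric.continuousAt_iff']
  intro ε hε
  obtain ⟨w, hw, hvw⟩ := Metric.mem_closure_iff.1 (hs v) (ε / 3) (by positivity)
  filter_upwards [Metric.continuousAt_iff'.1 (h w hw) (ε / 3) (by positivity)] with g hg
  calc dist (ρ g v) (ρ 1 v)
      ≤ dist (ρ g v) (ρ g w) + dist (ρ g w) (ρ 1 w) + dist (ρ 1 w) (ρ 1 v) := dist_triangle4 ..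
    _ = dist v w + dist (ρ g w) (ρ 1 w) + dist v w := by
        rw [(ρ g).dist_map, (ρ 1).dist_map, dist_comm w v]
    _ < ε := by linarith

end StrongContinuity

section SeparationQuotient

variable {E F : Type*} [SeminormedAddCommGroup E] [InnerProductSpace ℂ E]
  [NormedAddCommGroup F] [InnerProductSpace ℂ F]

/-- A surjective isometry from a seminormed space onto a normed space identifies the separation
quotient of the former with the latter; this is how `L²` spaces are mapped to other spaces. -/
def separationQuotientEquiv (J : E →ₗᵢ[ℂ] F) (hJ : Surjective J) :
    SeparationQuotient E ≃ₗᵢ[ℂ] F :=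
  LinearIsometryEquiv.ofSurjective
    { toLinearMap := (SeparationQuotient.liftCLM J.toContinuousLinearMap
        fun _ _ h => (h.map J.continuous).eq : SeparationQuotient E →L[ℂ] F)
      norm_map' := by
        rintro ⟨f⟩
        exact J.norm_map f }
    fun y => (hJ y).imp' SeparationQuotient.mk fun _ h => h

end SeparationQuotient

namespace FormField

variable {M M' : Type*} [MeasurableSpace M] [MeasurableSpace M']
  {𝓑 𝓑' : Type*} [AddCommGroup 𝓑] [Module ℂ 𝓑] [AddCommGroup 𝓑'] [Module ℂ 𝓑']
  {D : FormField M 𝓑} {D' : FormField M' 𝓑'} {μ : Measure M} {μ' : Measure M'}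

theorem PreL2.norm_sq (f : D.PreL2 μ) : ‖f‖ ^ 2 = ∫ x, (D.form x f.val f.val).re ∂μ := by
  rw [← inner_self_eq_norm_sq (𝕜 := ℂ), PreL2.inner_def]
  exact (integral_re (f.property.integrable f.property)).symm

variable {ι : M → M'} (hι : MeasurePreserving ι μ μ')

include hι

theorem sqIntegrable_map_iff {T : 𝓑 →ₗ[ℂ] 𝓑'}
    (hT : ∀ x f f', D'.form (ι x) (T f) (T f') = D.form x f f') (f : 𝓑) :
    D'.SqIntegrable μ' (T f) ↔ D.SqIntegrable μ f := by
  have hm : Measurable fun x => ENNReal.ofReal (D'.form x (T f) (T f)).re :=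
    (Complex.measurable_re.comp (measurable_form' _ _)).ennreal_ofReal
  simp only [SqIntegrable, ← hι.lintegral_comp hm, hT]

theorem integral_form_map {T : 𝓑 →ₗ[ℂ] 𝓑'}
    (hT : ∀ x f f', D'.form (ι x) (T f) (T f') = D.form x f f') (f f' : 𝓑) :
    ∫ x, D'.form x (T f) (T f') ∂μ' = ∫ x, D.form x f f' ∂μ := by
  rw [← hι.map_eq, integral_map hι.measurable.aemeasurable
    (measurable_form' _ _).aestronglyMeasurable]
  simp only [hT]

/-- The isometry of spaces of square-integrable elements induced by a form-preserving map. -/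
def PreL2.map (T : 𝓑 →ₗ[ℂ] 𝓑') (hT : ∀ x f f', D'.form (ι x) (T f) (T f') = D.form x f f') :
    D.PreL2 μ →ₗᵢ[ℂ] D'.PreL2 μ' :=
  LinearMap.isometryOfInner
    { toFun := fun f => ⟨T f.val, (sqIntegrable_map_iff hι hT _).2 f.property⟩
      map_add' := fun f f' => PreL2.ext (T.map_add f.val f'.val)
      map_smul' := fun c f => PreL2.ext (T.map_smul c f.val) }
    fun f f' => integral_form_map hι hT f.val f'.val

theorem PreL2.map_surjective {T : 𝓑 →ₗ[ℂ] 𝓑'} (hTs : Surjective T)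
    (hT : ∀ x f f', D'.form (ι x) (T f) (T f') = D.form x f f') :
    Surjective (PreL2.map hι T hT) := fun f' => by
  obtain ⟨f, hf⟩ := hTs f'.val
  exact ⟨⟨f, (sqIntegrable_map_iff hι hT f).1 (hf ▸ f'.property)⟩, PreL2.ext hf⟩

/-- The unitary operator of `L²` spaces induced by a surjective form-preserving map. -/
def l2Equiv (T : 𝓑 →ₗ[ℂ] 𝓑') (hTs : Surjective T)
    (hT : ∀ x f f', D'.form (ι x) (T f) (T f') = D.form x f f') : D.L2 μ ≃ₗᵢ[ℂ] D'.L2 μ' :=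
  separationQuotientEquiv
    { toLinearMap := (SeparationQuotient.mkCLM ℂ (D'.PreL2 μ')).toLinearMap ∘ₗ
        (PreL2.map hι T hT).toLinearMap
      norm_map' := fun f => (PreL2.map hι T hT).norm_map f }
    (SeparationQuotient.surjective_mk.comp (PreL2.map_surjective hι hTs hT))

theorem intertwines_l2Equiv {G : Type*} [Group G] {ρ : G →* Module.End ℂ 𝓑}
    {ρ' : G →* Module.End ℂ 𝓑'} {l : G →* Equiv.Perm M} {l' : G →* Equiv.Perm M'}
    {T : 𝓑 →ₗ[ℂ] 𝓑'} (hTs : Surjective T)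
    (hT : ∀ x f f', D'.form (ι x) (T f) (T f') = D.form x f f')
    (hl : ∀ g, MeasurePreserving (l g) μ μ)
    (h : ∀ g x f f', D.form (l g x) (ρ g f) (ρ g f') = D.form x f f')
    (hl' : ∀ g, MeasurePreserving (l' g) μ' μ')
    (h' : ∀ g x f f', D'.form (l' g x) (ρ' g f) (ρ' g f') = D'.form x f f')
    (hρ : ∀ g f, T (ρ g f) = ρ' g (T f)) :
    Intertwines (unitaryRep hl h) (unitaryRep hl' h') (l2Equiv hι T hTs hT) := by
  rintro g ⟨f⟩
  exact congrArg SeparationQuotient.mk (PreL2.ext (hρ g f.val))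

end FormField

section LpTensor

variable {M V : Type*} [MeasurableSpace M] (μ : Measure M)
  [NormedAddCommGroup V] [InnerProductSpace ℂ V]

/-- The linear map `L² ⊗ V → L²(V)`, `f ⊗ v ↦ (q ↦ f(q) v)`. -/
def lpTensorMap : (Lp ℂ 2 μ) ⊗[ℂ] V →ₗ[ℂ] Lp V 2 μ :=
  TensorProduct.lift (LinearMap.mk₂ ℂ
    (fun f v => (ContinuousLinearMap.toSpanSingleton ℂ v).compLp f)
    (fun f f' v => map_add ((ContinuousLinearMap.toSpanSingleton ℂ v).compLpL 2 μ) f f')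
    (fun c f v => map_smul ((ContinuousLinearMap.toSpanSingleton ℂ v).compLpL 2 μ) c f)
    (fun f v v' => by
      rw [ContinuousLinearMap.toSpanSingleton_add, ContinuousLinearMap.add_compLp])
    (fun c f v => by
      rw [ContinuousLinearMap.toSpanSingleton_smul, ContinuousLinearMap.smul_compLp]))

theorem coeFn_lpTensorMap_tmul (f : Lp ℂ 2 μ) (v : V) :
    lpTensorMap μ (f ⊗ₜ[ℂ] v) =ᵐ[μ] fun q => f q • v :=
  (ContinuousLinearMap.toSpanSingleton ℂ v).coeFn_compLp f

theorem inner_lpTensorMap (x y : (Lp ℂ 2 μ) ⊗[ℂ] V) :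
    inner ℂ (lpTensorMap μ x) (lpTensorMap μ y) = inner ℂ x y := by
  induction x with
  | zero => simp
  | add x x' hx hx' => rw [map_add, inner_add_left, inner_add_left, hx, hx']
  | tmul f v =>
    induction y with
    | zero => simp
    | add y y' hy hy' => rw [map_add, inner_add_right, inner_add_right, hy, hy']
    | tmul f' v' =>
      rw [TensorProduct.inner_tmul, L2.inner_def, L2.inner_def, ← integral_mul_const]
      refine integral_congr_ae ?_
      filter_upwards [coeFn_lpTensorMap_tmul μ f v, coeFn_lpTensorMap_tmul μ f' v'] with q h h'
      rw [h, h', inner_smul_left, inner_smul_right, RCLike.inner_apply]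
      ring

theorem lpTensorMap_surjective [FiniteDimensional ℂ V] :
    Surjective (lpTensorMap (V := V) μ) := by
  intro ψ
  let b := stdOrthonormalBasis ℂ V
  refine ⟨∑ i, ((innerSL ℂ (b i)).compLp ψ) ⊗ₜ[ℂ] b i, ?_⟩
  have h_tmul : ∀ᵐ q ∂μ, ∀ i, lpTensorMap μ (((innerSL ℂ (b i)).compLp ψ) ⊗ₜ[ℂ] b i) q =
      ((innerSL ℂ (b i)).compLp ψ) q • b i :=
    ae_all_iff.2 fun i => coeFn_lpTensorMap_tmul μ _ _
  have h_coord : ∀ᵐ q ∂μ, ∀ i, ((innerSL ℂ (b i)).compLp ψ) q = inner ℂ (b i) (ψ q) :=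
    ae_all_iff.2 fun i => (innerSL ℂ (b i)).coeFn_compLp ψ
  rw [map_sum]
  refine Lp.ext ((Lp.coeFn_finsetSum _ _).trans ?_)
  filter_upwards [h_tmul, h_coord] with q h_tmul h_coord
  simp only [Finset.sum_apply, h_tmul, h_coord]
  exact b.sum_repr' (ψ q)

/-- The unitary operator `L² ⊗ V ≃ L²(V)`, `f ⊗ v ↦ (q ↦ f(q) v)`. -/
def lpTensorEquiv [FiniteDimensional ℂ V] : (Lp ℂ 2 μ) ⊗[ℂ] V ≃ₗᵢ[ℂ] Lp V 2 μ :=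
  LinearIsometryEquiv.ofSurjective
    ((lpTensorMap (V := V) μ).isometryOfInner (inner_lpTensorMap μ)) (lpTensorMap_surjective μ)

end LpTensor

section Smooth

variable {E H M V W : Type*} [NormedAddCommGroup E] [NormedSpace ℝ E]
  [TopologicalSpace H] {I : ModelWithCorners ℝ E H} [TopologicalSpace M] [ChartedSpace H M]
  [NormedAddCommGroup V] [NormedSpace ℂ V] [NormedAddCommGroup W] [NormedSpace ℂ W]
  {n : WithTop ℕ∞}

theorem contMDiffOn_complexLinear_apply {s : Set M} {T : M → V →L[ℂ] W} {f : M → V}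
    (hT : ContMDiffOn I 𝓘(ℝ, V →L[ℂ] W) n T s) (hf : ContMDiffOn I 𝓘(ℝ, V) n f s) :
    ContMDiffOn I 𝓘(ℝ, W) n (fun x => T x (f x)) s :=
  have h_eval : ContDiff ℂ n fun p : (V →L[ℂ] W) × V => p.1 p.2 :=
    isBoundedBilinearMap_apply.contDiff
  (h_eval.restrict_scalars ℝ).contMDiff.comp_contMDiffOn (hT.prodMk_space hf)

theorem contMDiff_complexLinear_apply {T : M → V →L[ℂ] W} {f : M → V}
    (hT : ContMDiff I 𝓘(ℝ, V →L[ℂ] W) n T) (hf : ContMDiff I 𝓘(ℝ, V) n f) :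
    ContMDiff I 𝓘(ℝ, W) n fun x => T x (f x) :=
  contMDiffOn_univ.1 (contMDiffOn_complexLinear_apply hT.contMDiffOn hf.contMDiffOn)

theorem contMDiff_uncurry_complexLinear {T : M → V →L[ℂ] W} (hT : ContMDiff I 𝓘(ℝ, V →L[ℂ] W) n T) :
    ContMDiff (I.prod 𝓘(ℝ, V)) 𝓘(ℝ, W) n fun p : M × V => T p.1 p.2 :=
  contMDiff_complexLinear_apply (hT.comp contMDiff_fst) contMDiff_snd

theorem contMDiff_complexLinear_comp {X : Type*} [NormedAddCommGroup X] [NormedSpace ℂ X]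
    {T : M → V →L[ℂ] W} {R : M → X →L[ℂ] V} (hT : ContMDiff I 𝓘(ℝ, V →L[ℂ] W) n T)
    (hR : ContMDiff I 𝓘(ℝ, X →L[ℂ] V) n R) :
    ContMDiff I 𝓘(ℝ, X →L[ℂ] W) n fun x => (T x).comp (R x) :=
  have h_comp : ContDiff ℂ n fun p : (V →L[ℂ] W) × (X →L[ℂ] V) => p.1.comp p.2 :=
    isBoundedBilinearMap_comp.contDiff
  (h_comp.restrict_scalars ℝ).contMDiff.comp (hT.prodMk_space hR)

end Smooth

section Cocycle

variable (EG EM : Type*) {G M V : Type*} [Group G] [TopologicalSpace G]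
  [NormedAddCommGroup EG] [NormedSpace ℝ EG] [ChartedSpace EG G]
  [TopologicalSpace M] [NormedAddCommGroup EM] [NormedSpace ℝ EM] [ChartedSpace EM M]
  [NormedAddCommGroup V] [InnerProductSpace ℂ V]

/-- A smooth cocycle of the action `l` of `G` on `M` with values in the unitary group of `V`. Such
cocycles are the actions of `G` on the product bundle `M × V` that preserve the product metric. -/
structure IsSmoothUnitaryCocycle (l : G →* Equiv.Perm M) (c : G → M → V ≃ₗᵢ[ℂ] V) : Prop where
  one : ∀ q, c 1 q = 1
  mul : ∀ g g' q, c (g * g') q = c g (l g' q) * c g' q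
  smooth : ContMDiff (𝓘(ℝ, EG).prod 𝓘(ℝ, EM)) 𝓘(ℝ, V →L[ℂ] V) ∞
    fun p : G × M => ((c p.1 p.2).toContinuousLinearEquiv : V →L[ℂ] V)

end Cocycle

namespace HermitianGBundle

variable {EG EM : Type*} {G M : Type*} [Group G] [TopologicalSpace G]
  [NormedAddCommGroup EG] [NormedSpace ℝ EG] [ChartedSpace EG G]
  [TopologicalSpace M] [NormedAddCommGroup EM] [NormedSpace ℝ EM] [ChartedSpace EM M]
  {l : G →* Equiv.Perm M}

theorem act_eq_mk {V : Type*} [NormedAddCommGroup V] [NormedSpace ℂ V]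
    (E : HermitianGBundle EG EM l V) (g : G) {q : M} {v : V} (hv : v ∈ E.fiber q) :
    E.act g (q, v) = (l g q, (E.act g (q, v)).2) := Prod.ext (E.act_fst g (q, v) hv) rfl

theorem act_snd_mem_fiber {V : Type*} [NormedAddCommGroup V] [NormedSpace ℂ V]
    (E : HermitianGBundle EG EM l V) (g : G) {q : M} {v : V} (hv : v ∈ E.fiber q) :
    (E.act g (q, v)).2 ∈ E.fiber (l g q) := by
  have h := E.act_mem g (q, v) hv
  rw [E.act_eq_mk g hv] at h
  exact h

section Product

variable {V : Type*} [NormedAddCommGroup V] [InnerProductSpace ℂ V]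

theorem isSmoothSubbundle_top [FiniteDimensional ℂ V] :
    IsSmoothSubbundle EM (Module.finrank ℂ V) fun _ : M => (⊤ : Submodule ℂ V) := fun _ =>
  let b := Module.finBasis ℂ V
  ⟨univ, isOpen_univ, mem_univ _, fun i _ => b i, fun _ => contMDiffOn_const,
    fun _ _ => ⟨b.linearIndependent, b.span_eq⟩⟩

/-- The product bundle `M × V` with the inner product of `V` as its metric, on which `G` acts by a
smooth unitary cocycle: `g · (q, v) = (g q, c(g, q) v)`. -/
def product [FiniteDimensional ℂ V] {c : G → M → V ≃ₗᵢ[ℂ] V}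
    (hl : ContMDiff (𝓘(ℝ, EG).prod 𝓘(ℝ, EM)) 𝓘(ℝ, EM) ∞ fun p : G × M => l p.1 p.2)
    (hc : IsSmoothUnitaryCocycle EG EM l c) : HermitianGBundle EG EM l V where
  rank := Module.finrank ℂ V
  fiber _ := ⊤
  isSubbundle := isSmoothSubbundle_top
  metric _ v w := inner ℂ v w
  metric_add_left _ _ _ _ _ _ _ := inner_add_left _ _ _
  metric_smul_left _ _ _ _ _ _ := inner_smul_left _ _ _
  metric_conj _ _ _ _ _ := inner_conj_symm _ _
  metric_pos _ _ _ hu := re_inner_self_pos (𝕜 := ℂ).2 hu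
  smooth_metric :=
    have h_inner : ContMDiff 𝓘(ℝ, V × V) 𝓘(ℝ, ℂ) ∞ fun p : V × V => inner ℂ p.1 p.2 :=
      (contDiff_fst.inner ℂ contDiff_snd).contMDiff
    (h_inner.comp ((contMDiff_fst.comp contMDiff_snd).prodMk_space
      (contMDiff_snd.comp contMDiff_snd))).contMDiffOn
  smooth_base := hl
  act g p := (l g p.1, c g p.1 p.2)
  act_fst _ _ _ := rfl
  act_mem _ _ _ := trivial
  act_one p _ := by simp [hc.one]
  act_mul g g' p _ := by simp [hc.mul]
  act_add g x _ _ _ _ := map_add (c g x) _ _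
  act_smul g x _ _ _ := map_smul (c g x) _ _
  act_isometry g x _ _ _ _ := (c g x).inner_map_map _ _
  smooth_act :=
    have h_base := hl.comp (contMDiff_fst.prodMk (contMDiff_fst.comp contMDiff_snd))
    have h_cocycle := hc.smooth.comp (contMDiff_fst.prodMk (contMDiff_fst.comp contMDiff_snd))
    h_base.contMDiffOn.prodMk (contMDiffOn_complexLinear_apply h_cocycle.contMDiffOn
      (contMDiff_snd.comp contMDiff_snd).contMDiffOn)

end Product

section Pushforward

variable {V K : Type*} [NormedAddCommGroup V] [NormedSpace ℂ V]
  [NormedAddCommGroup K] [NormedSpace ℂ K] {a : M → V →L[ℂ] K} {b : M → K →L[ℂ] V}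

theorem isSmoothSubbundle_map {r : ℕ} {F : M → Submodule ℂ V} (hF : IsSmoothSubbundle EM r F)
    (ha : ContMDiff 𝓘(ℝ, EM) 𝓘(ℝ, V →L[ℂ] K) ∞ a) (ha' : ∀ q, Injective (a q)) :
    IsSmoothSubbundle EM r fun q => (F q).map (a q : V →ₗ[ℂ] K) := fun x₀ => by
  obtain ⟨U, hU, hx₀, s, hs, hsF⟩ := hF x₀
  refine ⟨U, hU, hx₀, fun i q => a q (s i q),
    fun i => contMDiffOn_complexLinear_apply ha.contMDiffOn (hs i), fun q hq => ⟨?_, ?_⟩⟩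
  · exact (hsF q hq).1.map' (a q : V →ₗ[ℂ] K) (LinearMap.ker_eq_bot.2 (ha' q))
  · beta_reduce
    rw [← (hsF q hq).2, Submodule.map_span, ← range_comp]
    rfl

theorem apply_mem_fiber_of_mem_map (E : HermitianGBundle EG EM l V) (hba : ∀ q v, b q (a q v) = v)
    {q : M} {v : K} (hv : v ∈ (E.fiber q).map (a q : V →ₗ[ℂ] K)) :
    b q v ∈ E.fiber q ∧ a q (b q v) = v := by
  obtain ⟨u, hu, rfl⟩ := hv
  exact ⟨by simpa [hba] using hu, by simp [hba]⟩

/-- The image of the bundle `E` under a smooth family of injections `a q : V → K` with smooth left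
inverses `b q`, with the metric and the action of `E` transported along `a`. -/
def pushforward (E : HermitianGBundle EG EM l V)
    (ha : ContMDiff 𝓘(ℝ, EM) 𝓘(ℝ, V →L[ℂ] K) ∞ a) (hb : ContMDiff 𝓘(ℝ, EM) 𝓘(ℝ, K →L[ℂ] V) ∞ b)
    (hba : ∀ q v, b q (a q v) = v) : HermitianGBundle EG EM l K where
  rank := E.rank
  fiber q := (E.fiber q).map (a q : V →ₗ[ℂ] K)
  isSubbundle := isSmoothSubbundle_map E.isSubbundle ha fun q => LeftInverse.injective (hba q)
  metric q v w := E.metric q (b q v) (b q w)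
  metric_add_left q u hu v hv w hw := by
    rw [map_add]
    exact E.metric_add_left q _ (E.apply_mem_fiber_of_mem_map hba hu).1
      _ (E.apply_mem_fiber_of_mem_map hba hv).1 _ (E.apply_mem_fiber_of_mem_map hba hw).1
  metric_smul_left q c u hu v hv := by
    rw [map_smul]
    exact E.metric_smul_left q c _ (E.apply_mem_fiber_of_mem_map hba hu).1
      _ (E.apply_mem_fiber_of_mem_map hba hv).1
  metric_conj q u hu v hv := E.metric_conj q _ (E.apply_mem_fiber_of_mem_map hba hu).1
    _ (E.apply_mem_fiber_of_mem_map hba hv).1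
  metric_pos q u hu hu0 := E.metric_pos q _ (E.apply_mem_fiber_of_mem_map hba hu).1 fun h0 =>
    hu0 (by rw [← (E.apply_mem_fiber_of_mem_map hba hu).2, h0, map_zero])
  smooth_metric := by
    have h_b := contMDiff_uncurry_complexLinear hb
    have h_pull : ContMDiff (𝓘(ℝ, EM).prod (𝓘(ℝ, K).prod 𝓘(ℝ, K)))
        (𝓘(ℝ, EM).prod (𝓘(ℝ, V).prod 𝓘(ℝ, V))) ∞
        fun p : M × (K × K) => (p.1, b p.1 p.2.1, b p.1 p.2.2) :=
      contMDiff_fst.prodMk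
        ((h_b.comp (contMDiff_fst.prodMk (contMDiff_fst.comp contMDiff_snd))).prodMk
          (h_b.comp (contMDiff_fst.prodMk (contMDiff_snd.comp contMDiff_snd))))
    exact E.smooth_metric.comp h_pull.contMDiffOn fun p hp =>
      ⟨(E.apply_mem_fiber_of_mem_map hba hp.1).1, (E.apply_mem_fiber_of_mem_map hba hp.2).1⟩
  smooth_base := E.smooth_base
  act g p := (l g p.1, a (l g p.1) (E.act g (p.1, b p.1 p.2)).2)
  act_fst _ _ _ := rfl
  act_mem g p hp := Submodule.mem_map_of_mem
    (E.act_snd_mem_fiber g (E.apply_mem_fiber_of_mem_map hba hp).1)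
  act_one p hp := by
    have hp' := E.apply_mem_fiber_of_mem_map hba hp
    simp [E.act_one (p.1, b p.1 p.2) hp'.1, hp'.2]
  act_mul g g' p hp := by
    have hp' := E.apply_mem_fiber_of_mem_map hba hp
    rw [E.act_mul g g' (p.1, b p.1 p.2) hp'.1, E.act_eq_mk g' hp'.1]
    simp only [hba, map_mul, Equiv.Perm.mul_apply]
  act_add g x u hu v hv := by
    simp only [map_add]
    rw [E.act_add g x _ (E.apply_mem_fiber_of_mem_map hba hu).1
      _ (E.apply_mem_fiber_of_mem_map hba hv).1, map_add]
  act_smul g x c u hu := by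
    simp only [map_smul]
    rw [E.act_smul g x c _ (E.apply_mem_fiber_of_mem_map hba hu).1, map_smul]
  act_isometry g x u hu v hv := by
    simp only [hba]
    exact E.act_isometry g x _ (E.apply_mem_fiber_of_mem_map hba hu).1
      _ (E.apply_mem_fiber_of_mem_map hba hv).1
  smooth_act := by
    have h_base : ContMDiff (𝓘(ℝ, EG).prod (𝓘(ℝ, EM).prod 𝓘(ℝ, K))) 𝓘(ℝ, EM) ∞
        fun p : G × (M × K) => l p.1 p.2.1 :=
      E.smooth_base.comp (contMDiff_fst.prodMk (contMDiff_fst.comp contMDiff_snd))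
    have h_pull : ContMDiff (𝓘(ℝ, EG).prod (𝓘(ℝ, EM).prod 𝓘(ℝ, K)))
        (𝓘(ℝ, EG).prod (𝓘(ℝ, EM).prod 𝓘(ℝ, V))) ∞
        fun p : G × (M × K) => (p.1, p.2.1, b p.2.1 p.2.2) :=
      contMDiff_fst.prodMk ((contMDiff_fst.comp contMDiff_snd).prodMk
        ((contMDiff_uncurry_complexLinear hb).comp contMDiff_snd))
    exact h_base.contMDiffOn.prodMk (contMDiffOn_complexLinear_apply (ha.comp h_base).contMDiffOn
      (contMDiff_snd.comp_contMDiffOn (E.smooth_act.comp h_pull.contMDiffOn fun p hp =>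
        ⟨mem_univ _, (E.apply_mem_fiber_of_mem_map hba hp.2).1⟩)))

theorem isIso_pushforward (E : HermitianGBundle EG EM l V)
    (ha : ContMDiff 𝓘(ℝ, EM) 𝓘(ℝ, V →L[ℂ] K) ∞ a) (hb : ContMDiff 𝓘(ℝ, EM) 𝓘(ℝ, K →L[ℂ] V) ∞ b)
    (hba : ∀ q v, b q (a q v) = v) :
    E.IsIso (E.pushforward ha hb hba) fun p => (p.1, a p.1 p.2) := by
  refine ⟨?_, fun p => (p.1, b p.1 p.2), ?_, ?_⟩
  · exact
    { mapsTo := fun p hp => Submodule.mem_map_of_mem hp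
      map_base := fun _ _ => rfl
      map_add := fun x _ _ _ _ => map_add (a x) _ _
      map_smul := fun x _ _ _ => map_smul (a x) _ _
      isometry := fun x u _ v _ => by simp only [pushforward, hba]
      equivariant := fun g p hp => by simp only [pushforward, hba, E.act_fst g p hp]
      smooth := (contMDiff_fst.prodMk (contMDiff_uncurry_complexLinear ha)).contMDiffOn }
  · exact
    { mapsTo := fun p hp => (E.apply_mem_fiber_of_mem_map hba hp).1
      map_base := fun _ _ => rfl
      map_add := fun x _ _ _ _ => map_add (b x) _ _
      map_smul := fun x _ _ _ => map_smul (b x) _ _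
      isometry := fun _ _ _ _ _ => rfl
      equivariant := fun g p hp => by
        simp only [pushforward, hba]
        exact (E.act_eq_mk g (E.apply_mem_fiber_of_mem_map hba hp).1).symm
      smooth := (contMDiff_fst.prodMk (contMDiff_uncurry_complexLinear hb)).contMDiffOn }
  · exact ⟨fun p _ => Prod.ext rfl (hba p.1 p.2),
      fun p hp => Prod.ext rfl (E.apply_mem_fiber_of_mem_map hba hp).2⟩

end Pushforward

end HermitianGBundle

theorem translate_sub_eq_zero {G M V : Type*} [Group G] [TopologicalSpace M]
    [NormedAddCommGroup V] [InnerProductSpace ℂ V] {l : G →* Equiv.Perm M}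
    {c : G → M → V ≃ₗᵢ[ℂ] V} {C : Set G} {ψ : M → V} {g : G} (hg : g ∈ C) {q : M}
    (hq : q ∉ (fun p : G × M => l p.1 p.2) '' (C ×ˢ tsupport ψ) ∪ tsupport ψ) :
    c g (l g⁻¹ q) (ψ (l g⁻¹ q)) - ψ q = 0 := by
  have hψq : ψ q = 0 := image_eq_zero_of_notMem_tsupport fun h => hq (Or.inr h)
  have hψg : ψ (l g⁻¹ q) = 0 := image_eq_zero_of_notMem_tsupport fun h =>
    hq (Or.inl ⟨(g, l g⁻¹ q), ⟨hg, h⟩, by simp⟩)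
  rw [hψg, map_zero, hψq, sub_zero]

namespace HermitianGBundle

variable {EG EM : Type*} {G M : Type*} [Group G] [TopologicalSpace G]
  [NormedAddCommGroup EG] [NormedSpace ℝ EG] [ChartedSpace EG G]
  [TopologicalSpace M] [NormedAddCommGroup EM] [NormedSpace ℝ EM] [ChartedSpace EM M]
  {l : G →* Equiv.Perm M}

section MapSections

variable {K K' : Type*} [NormedAddCommGroup K] [NormedSpace ℂ K]
  [NormedAddCommGroup K'] [NormedSpace ℂ K']
  {E : HermitianGBundle EG EM l K} {E' : HermitianGBundle EG EM l K'}
  {A : M × K → M × K'} {B : M × K' → M × K}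

theorem IsHom.apply_eq_mk (hA : E.IsHom E' A) {q : M} {v : K} (hv : v ∈ E.fiber q) :
    A (q, v) = (q, (A (q, v)).2) := Prod.ext (hA.map_base (q, v) hv) rfl

theorem IsHom.apply_snd_mem_fiber (hA : E.IsHom E' A) {q : M} {v : K} (hv : v ∈ E.fiber q) :
    (A (q, v)).2 ∈ E'.fiber q := by
  have h : A (q, v) ∈ E'.total := hA.mapsTo hv
  rw [hA.apply_eq_mk hv] at h
  exact h

theorem IsHom.apply_act_snd (hA : E.IsHom E' A) (g : G) {q : M} {v : K} (hv : v ∈ E.fiber q) :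
    (A (l g q, (E.act g (q, v)).2)).2 = (E'.act g (q, (A (q, v)).2)).2 := by
  rw [← E.act_eq_mk g hv, hA.equivariant g (q, v) hv, ← hA.apply_eq_mk hv]

variable [MeasurableSpace M] [OpensMeasurableSpace M]
  [FiniteDimensional ℂ K] [MeasurableSpace K] [BorelSpace K]
  [FiniteDimensional ℂ K'] [MeasurableSpace K'] [BorelSpace K']

/-- Composition of Borel sections with a homomorphism of Hermitian `G`-bundles. -/
def IsHom.mapSections (hA : E.IsHom E' A) : E.borelSections →ₗ[ℂ] E'.borelSections where
  toFun ψ :=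
    have := secondCountable_of_finiteDimensional K
    ⟨fun q => (A (q, ψ.1 q)).2,
      measurable_comp_of_continuousOn (continuous_snd.comp_continuousOn hA.smooth.continuousOn)
        (measurable_id.prodMk ψ.2.1) ψ.2.2,
      fun q => hA.apply_snd_mem_fiber (ψ.2.2 q)⟩
  map_add' ψ φ := Subtype.ext (funext fun q => hA.map_add q _ (ψ.2.2 q) _ (φ.2.2 q))
  map_smul' c ψ := Subtype.ext (funext fun q => hA.map_smul q c _ (ψ.2.2 q))

theorem IsHom.mapSections_surjective (hA : E.IsHom E' A) (hB : E'.IsHom E B)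
    (hAB : RightInvOn B A E'.total) : Surjective hA.mapSections := fun φ =>
  ⟨hB.mapSections φ, Subtype.ext (funext fun q => by
    change (A (q, (B (q, φ.1 q)).2)).2 = φ.1 q
    rw [← hB.apply_eq_mk (φ.2.2 q), hAB (φ.2.2 q : (q, φ.1 q) ∈ E'.total)])⟩

theorem IsHom.mapSections_sectionAction (hA : E.IsHom E' A) (hl : ∀ g, Measurable (l g)) (g : G)
    (ψ : E.borelSections) :
    hA.mapSections (E.sectionAction hl g ψ) = E'.sectionAction hl g (hA.mapSections ψ) := by
  refine Subtype.ext (funext fun q => ?_)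
  change (A (q, (E.act g (l g⁻¹ q, ψ.1 (l g⁻¹ q))).2)).2 =
    (E'.act g (l g⁻¹ q, (A (l g⁻¹ q, ψ.1 (l g⁻¹ q))).2)).2
  rw [← hA.apply_act_snd g (ψ.2.2 _), show l g (l g⁻¹ q) = q by simp]

theorem IsIso.exists_intertwines (hA : E.IsIso E' A) (μ : Measure M)
    (hμ : ∀ g, MeasurePreserving (l g) μ μ) :
    ∃ T : E.L2 μ ≃ₗᵢ[ℂ] E'.L2 μ, Intertwines (E.inducedRep μ hμ) (E'.inducedRep μ hμ) T ∧
      ∀ ψ : E.PreL2 μ, ∃ φ : E'.PreL2 μ,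
        (∀ q, (q, sec φ q) = A (q, sec ψ q)) ∧ T (cls ψ) = cls φ := by
  obtain ⟨hA, B, hB, hAB⟩ := hA
  have h_form : ∀ q ψ φ, E'.formField.form (id q) (hA.mapSections ψ) (hA.mapSections φ) =
      E.formField.form q ψ φ := fun q ψ φ => hA.isometry q _ (ψ.2.2 q) _ (φ.2.2 q)
  have hid := MeasurePreserving.id μ
  exact ⟨FormField.l2Equiv hid hA.mapSections (hA.mapSections_surjective hB hAB.2) h_form,
    FormField.intertwines_l2Equiv hid _ h_form _ _ _ _ (hA.mapSections_sectionAction _),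
    fun ψ => ⟨FormField.PreL2.map hid hA.mapSections h_form ψ,
      fun q => (hA.apply_eq_mk (ψ.val.2.2 q)).symm, rfl⟩⟩

end MapSections

section ProductSections

variable {V : Type*} [NormedAddCommGroup V] [InnerProductSpace ℂ V] [FiniteDimensional ℂ V]
  {c : G → M → V ≃ₗᵢ[ℂ] V}
  {hl : ContMDiff (𝓘(ℝ, EG).prod 𝓘(ℝ, EM)) 𝓘(ℝ, EM) ∞ fun p : G × M => l p.1 p.2}
  {hc : IsSmoothUnitaryCocycle EG EM l c}
  [MeasurableSpace V] [BorelSpace V] [MeasurableSpace M] [OpensMeasurableSpace M]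
  {μ : Measure M}

theorem sqIntegrable_product_iff {ψ : (product hl hc).borelSections} :
    (product hl hc).formField.SqIntegrable μ ψ ↔ MemLp ψ.1 2 μ := by
  have := secondCountable_of_finiteDimensional V
  have h_form : ∀ q, ((product hl hc).formField.form q ψ ψ).re = ‖ψ.1 q‖ ^ 2 := fun q =>
    inner_self_eq_norm_sq (𝕜 := ℂ) _
  rw [memLp_two_iff_integrable_sq_norm ψ.2.1.aestronglyMeasurable]
  refine ⟨fun hψ => by simpa only [h_form] using hψ.integrable_re, fun hψ => ?_⟩
  have h_fin := hψ.hasFiniteIntegral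
  rw [hasFiniteIntegral_iff_ofReal (Filter.Eventually.of_forall fun q => by positivity)] at h_fin
  simpa only [FormField.SqIntegrable, h_form] using h_fin

theorem memLp_sec (ψ : (product hl hc).PreL2 μ) : MemLp (sec ψ) 2 μ :=
  sqIntegrable_product_iff.1 ψ.property

variable (hl hc μ) in
/-- The isometry that sends a square-integrable section of a product bundle to its class in
`L²(V)`. -/
def toLpIsometry : (product hl hc).PreL2 μ →ₗᵢ[ℂ] Lp V 2 μ :=
  LinearMap.isometryOfInner
    { toFun := fun ψ => (memLp_sec ψ).toLp _
      map_add' := fun _ _ => rfl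
      map_smul' := fun _ _ => rfl } fun ψ φ => by
    rw [L2.inner_def, FormField.PreL2.inner_def]
    refine integral_congr_ae ?_
    filter_upwards [(memLp_sec ψ).coeFn_toLp, (memLp_sec φ).coeFn_toLp] with q hψ hφ
    change inner ℂ ((memLp_sec ψ).toLp _ q) ((memLp_sec φ).toLp _ q) = _
    rw [hψ, hφ]
    rfl

theorem toLpIsometry_apply (ψ : (product hl hc).PreL2 μ) :
    toLpIsometry hl hc μ ψ = (memLp_sec ψ).toLp (sec ψ) := rfl

theorem exists_sec_eq {f : M → V} (hf : Measurable f) (hf2 : MemLp f 2 μ) :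
    ∃ ψ : (product hl hc).PreL2 μ, sec ψ = f :=
  ⟨⟨⟨f, hf, fun _ => trivial⟩, sqIntegrable_product_iff.2 hf2⟩, rfl⟩

theorem toLpIsometry_surjective : Surjective (toLpIsometry hl hc μ) := fun f => by
  obtain ⟨ψ, hψ⟩ := exists_sec_eq (hl := hl) (hc := hc)
    (Lp.stronglyMeasurable f).measurable (Lp.memLp f)
  refine ⟨ψ, ?_⟩
  simp only [toLpIsometry_apply, hψ, Lp.toLp_coeFn]

variable (hl hc μ) in
/-- The space of square-integrable sections of a product bundle is `L²(V)`. -/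
def l2EquivLp : (product hl hc).L2 μ ≃ₗᵢ[ℂ] Lp V 2 μ :=
  separationQuotientEquiv (toLpIsometry hl hc μ) toLpIsometry_surjective

theorem l2EquivLp_cls (ψ : (product hl hc).PreL2 μ) :
    l2EquivLp hl hc μ (cls ψ) = (memLp_sec ψ).toLp (sec ψ) := rfl

variable (hl hc μ) in
theorem exists_tensor_equiv : ∃ T : (Lp ℂ 2 μ) ⊗[ℂ] V ≃ₗᵢ[ℂ] (product hl hc).L2 μ,
    ∀ (f : Lp ℂ 2 μ) (v : V), ∃ ψ : (product hl hc).PreL2 μ,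
      (∀ᵐ q ∂μ, sec ψ q = f q • v) ∧ T (f ⊗ₜ[ℂ] v) = cls ψ := by
  refine ⟨(lpTensorEquiv μ).trans (l2EquivLp hl hc μ).symm, fun f v => ?_⟩
  obtain ⟨ψ, hψ⟩ := toLpIsometry_surjective (hl := hl) (hc := hc) (lpTensorMap μ (f ⊗ₜ[ℂ] v))
  refine ⟨ψ, ?_, ?_⟩
  · filter_upwards [(memLp_sec ψ).coeFn_toLp, coeFn_lpTensorMap_tmul μ f v] with q h_sec h_tmul
    rw [← h_sec, ← toLpIsometry_apply, hψ, h_tmul]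
  · rw [LinearIsometryEquiv.trans_apply, LinearIsometryEquiv.symm_apply_eq, l2EquivLp_cls,
      ← toLpIsometry_apply, hψ]
    rfl

theorem dist_cls (ψ φ : (product hl hc).PreL2 μ) :
    dist (cls ψ) (cls φ) = √(∫ q, ‖sec ψ q - sec φ q‖ ^ 2 ∂μ) := by
  have h_sub : ‖ψ - φ‖ ^ 2 = ∫ q, ‖sec ψ q - sec φ q‖ ^ 2 ∂μ :=
    (FormField.PreL2.norm_sq _).trans (integral_congr_ae (Filter.Eventually.of_forall fun q =>
      inner_self_eq_norm_sq (𝕜 := ℂ) (sec ψ q - sec φ q)))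
  rw [← h_sub, Real.sqrt_sq (norm_nonneg _)]
  exact (SeparationQuotient.dist_mk ψ φ).trans (dist_eq_norm ψ φ)

theorem dist_inducedRep_cls (hμ : ∀ g, MeasurePreserving (l g) μ μ)
    (ψ : (product hl hc).PreL2 μ) (g : G) :
    dist ((product hl hc).inducedRep μ hμ g (cls ψ)) (cls ψ) =
      √(∫ q, ‖c g (l g⁻¹ q) (sec ψ (l g⁻¹ q)) - sec ψ q‖ ^ 2 ∂μ) := by
  obtain ⟨φ, hφ, h_sec⟩ : ∃ φ : (product hl hc).PreL2 μ,
      (product hl hc).inducedRep μ hμ g (cls ψ) = cls φ ∧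
        ∀ q, sec φ q = c g (l g⁻¹ q) (sec ψ (l g⁻¹ q)) := ⟨_, rfl, fun _ => rfl⟩
  rw [hφ, dist_cls]
  simp only [h_sec]

end ProductSections

section StrongContinuity

variable {V : Type*} [NormedAddCommGroup V] [InnerProductSpace ℂ V] {c : G → M → V ≃ₗᵢ[ℂ] V}
  {hl : ContMDiff (𝓘(ℝ, EG).prod 𝓘(ℝ, EM)) 𝓘(ℝ, EM) ∞ fun p : G × M => l p.1 p.2}
  {hc : IsSmoothUnitaryCocycle EG EM l c}

include hl hc in
theorem continuous_norm_translate_sub [ContinuousInv G] {ψ : M → V} (hψ : Continuous ψ) :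
    Continuous fun p : G × M => ‖c p.1 (l p.1⁻¹ p.2) (ψ (l p.1⁻¹ p.2)) - ψ p.2‖ ^ 2 := by
  have h_base : Continuous fun p : G × M => l p.1⁻¹ p.2 :=
    hl.continuous.comp (continuous_fst.inv.prodMk continuous_snd)
  have h_cocycle : Continuous fun p : G × M =>
      ((c p.1 (l p.1⁻¹ p.2)).toContinuousLinearEquiv : V →L[ℂ] V) :=
    hc.smooth.continuous.comp (continuous_fst.prodMk h_base)
  exact ((h_cocycle.clm_apply (hψ.comp h_base)).sub (hψ.comp continuous_snd)).norm.pow 2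

variable [FiniteDimensional ℂ V] [MeasurableSpace V] [BorelSpace V]
  [MeasurableSpace M] {μ : Measure M} [IsFiniteMeasureOnCompacts μ]

theorem continuousAt_inducedRep_of_hasCompactSupport [OpensMeasurableSpace M]
    [IsTopologicalGroup G] [LocallyCompactSpace G]
    (hμ : ∀ g, MeasurePreserving (l g) μ μ) {ψ : (product hl hc).PreL2 μ}
    (hψ : Continuous (sec ψ)) (hψs : HasCompactSupport (sec ψ)) :
    ContinuousAt (fun g => (product hl hc).inducedRep μ hμ g (cls ψ)) 1 := by
  obtain ⟨C, hC, hC1⟩ := exists_compact_mem_nhds (1 : G)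
  have h_compact : IsCompact ((fun p : G × M => l p.1 p.2) '' (C ×ˢ tsupport (sec ψ)) ∪
      tsupport (sec ψ)) := ((hC.prod hψs).image hl.continuous).union hψs
  have h_integral : ContinuousAt
      (fun g => ∫ q, ‖c g (l g⁻¹ q) (sec ψ (l g⁻¹ q)) - sec ψ q‖ ^ 2 ∂μ) 1 :=
    (continuousOn_integral_of_compact_support h_compact
      (continuous_norm_translate_sub (hl := hl) (hc := hc) hψ).continuousOn
      fun g q hg hq => by simp only [translate_sub_eq_zero hg hq, norm_zero, zero_pow two_ne_zero]
      ).continuousAt hC1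
  have h_one : (product hl hc).inducedRep μ hμ 1 (cls ψ) = cls ψ := by
    rw [map_one, LinearIsometryEquiv.coe_one, id]
  rw [ContinuousAt, h_one, tendsto_iff_dist_tendsto_zero]
  simp only [dist_inducedRep_cls]
  simpa [ContinuousAt, hc.one] using h_integral.sqrt

variable [BorelSpace M] [T2Space M] [LocallyCompactSpace M] [SecondCountableTopology M]

theorem dense_cls_hasCompactSupport :
    Dense {x : (product hl hc).L2 μ | ∃ ψ : (product hl hc).PreL2 μ,
      Continuous (sec ψ) ∧ HasCompactSupport (sec ψ) ∧ cls ψ = x} := by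
  have := secondCountable_of_finiteDimensional V
  have := TopologicalSpace.metrizableSpace_of_t3_secondCountable M
  intro x
  obtain ⟨ψ, rfl⟩ := SeparationQuotient.surjective_mk x
  refine Metric.mem_closure_iff.2 fun ε hε => ?_
  obtain ⟨f, hfs, hfε, hfc, hf⟩ := (memLp_sec ψ).exists_hasCompactSupport_eLpNorm_sub_le
    (by simp) (ε := ENNReal.ofReal (ε / 2)) (by simpa using hε)
  obtain ⟨φ, rfl⟩ := exists_sec_eq (hl := hl) (hc := hc) hfc.measurable hf
  refine ⟨cls φ, ⟨φ, hfc, hfs, rfl⟩, ?_⟩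
  calc dist (cls ψ) (cls φ)
      = dist ((memLp_sec ψ).toLp (sec ψ)) ((memLp_sec φ).toLp (sec φ)) :=
        ((l2EquivLp hl hc μ).dist_map (cls ψ) (cls φ)).symm
    _ = (eLpNorm (sec ψ - sec φ) 2 μ).toReal := by
        rw [Lp.dist_def, eLpNorm_congr_ae
          ((memLp_sec ψ).coeFn_toLp.sub (memLp_sec φ).coeFn_toLp)]
    _ ≤ ε / 2 := ENNReal.toReal_le_of_le_ofReal (by positivity) hfε
    _ < ε := half_lt_self hε

theorem isUnitaryRepresentation_product [IsTopologicalGroup G] [LocallyCompactSpace G]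
    (hμ : ∀ g, MeasurePreserving (l g) μ μ) :
    IsUnitaryRepresentation ((product hl hc).inducedRep μ hμ) := by
  let T := l2EquivLp hl hc μ
  refine ⟨(completeSpace_congr (e := T.toEquiv)
    T.isometry.isUniformInducing.isUniformEmbedding).2 inferInstance,
    fun v => continuous_orbit_of_continuousAt_one
      (continuousAt_one_orbit_of_dense dense_cls_hasCompactSupport ?_ v)⟩
  rintro _ ⟨ψ, hψ, hψs, rfl⟩
  exact continuousAt_inducedRep_of_hasCompactSupport hμ hψ hψs

end StrongContinuity

end HermitianGBundle

namespace HermitianGBundle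

variable {EG EM : Type*} {G M : Type*} [Group G] [TopologicalSpace G]
  [NormedAddCommGroup EG] [NormedSpace ℝ EG] [ChartedSpace EG G]
  [TopologicalSpace M] [NormedAddCommGroup EM] [NormedSpace ℝ EM] [ChartedSpace EM M]
  {l : G →* Equiv.Perm M} {K : Type*} [NormedAddCommGroup K] [NormedSpace ℂ K]
  {V : Type*} [NormedAddCommGroup V] [InnerProductSpace ℂ V]
  {E : HermitianGBundle EG EM l K} {q₀ : M} {S : Subgroup G} {τ : S →* (V ≃ₗᵢ[ℂ] V)}
  {θ : V ≃ₗ[ℂ] E.fiber q₀}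

/-- The isotropy group of `q₀` is `S`, and `θ` identifies the unitary representation `τ` of `S` with
the action of `S` on the fiber of `E` at `q₀`. -/
structure IsIsotropyRep (E : HermitianGBundle EG EM l K) (q₀ : M) (τ : S →* (V ≃ₗᵢ[ℂ] V))
    (θ : V ≃ₗ[ℂ] E.fiber q₀) : Prop where
  mem_iff : ∀ g, g ∈ S ↔ l g q₀ = q₀
  metric : ∀ v w, E.metric q₀ (θ v) (θ w) = inner ℂ v w
  act : ∀ (k : S) v, (E.act k (q₀, θ v)).2 = θ (τ k v)

variable [FiniteDimensional ℂ K] [MeasurableSpace K] [BorelSpace K]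
  [MeasurableSpace M] [BorelSpace M]

section Measurability

variable [MeasurableSpace G] [OpensMeasurableSpace G] [SecondCountableTopology G]

theorem measurable_act_snd (E : HermitianGBundle EG EM l K) {X : Type*} [MeasurableSpace X]
    {g : X → G} {q : X → M} {v : X → K} (hg : Measurable g) (hq : Measurable q) (hv : Measurable v)
    (hvq : ∀ x, v x ∈ E.fiber (q x)) : Measurable fun x => (E.act (g x) (q x, v x)).2 :=
  have := secondCountable_of_finiteDimensional K
  measurable_comp_of_continuousOn (continuous_snd.comp_continuousOn E.smooth_act.continuousOn)
    (hg.prodMk (hq.prodMk hv)) fun x => ⟨mem_univ _, hvq x⟩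

end Measurability

variable (hl : ∀ g, Measurable (l g))

theorem sectionAction_inv_apply (g : G) (ψ : E.borelSections) (q : M) :
    (E.sectionAction hl g⁻¹ ψ).1 q = (E.act g⁻¹ (l g q, ψ.1 (l g q))).2 := by
  change (E.act g⁻¹ (l g⁻¹⁻¹ q, ψ.1 (l g⁻¹⁻¹ q))).2 = _
  rw [inv_inv]

variable [FiniteDimensional ℂ V] [MeasurableSpace V] [BorelSpace V]
  [IsTopologicalGroup G] [MeasurableSpace G] [BorelSpace G] [SecondCountableTopology G]

/-- The function `g ↦ θ⁻¹ ((g⁻¹ · ψ) q₀)` on `G` associated with a section `ψ`. -/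
def IsIsotropyRep.toEquivariant (h : E.IsIsotropyRep q₀ τ θ) :
    E.borelSections →ₗ[ℂ] equivariantFunctions S τ where
  toFun ψ := ⟨fun g => θ.symm ⟨(E.sectionAction hl g⁻¹ ψ).1 q₀, (E.sectionAction hl g⁻¹ ψ).2.2 q₀⟩,
    by
      have h_orbit : Measurable fun g => l g q₀ :=
        (E.smooth_base.continuous.comp (continuous_id.prodMk continuous_const)).measurable
      refine (LinearMap.continuous_of_finiteDimensional
        θ.symm.toLinearMap).measurable.comp (Measurable.subtype_mk ?_)
      simp only [sectionAction_inv_apply]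
      exact E.measurable_act_snd measurable_inv h_orbit (ψ.2.1.comp h_orbit) fun g => ψ.2.2 _,
    fun g k => by
      rw [θ.symm_apply_eq]
      refine Subtype.ext ?_
      have hk : l (k : G) q₀ = q₀ := (h.mem_iff k).1 k.2
      rw [← map_inv, ← h.act, θ.apply_symm_apply]
      simp only [mul_inv_rev, map_mul, Module.End.mul_apply]
      rw [sectionAction_inv_apply, hk]
      rfl⟩
  map_add' ψ φ := Subtype.ext (funext fun g => by
    simp only [map_add]
    exact θ.symm.map_add ⟨_, (E.sectionAction hl g⁻¹ ψ).2.2 q₀⟩ ⟨_, _⟩)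
  map_smul' c ψ := Subtype.ext (funext fun g => by
    simp only [map_smul]
    exact θ.symm.map_smul c ⟨_, (E.sectionAction hl g⁻¹ ψ).2.2 q₀⟩)

theorem IsIsotropyRep.apply_toEquivariant (h : E.IsIsotropyRep q₀ τ θ) (ψ : E.borelSections)
    (g : G) : (θ ((h.toEquivariant hl ψ).1 g) : K) = (E.sectionAction hl g⁻¹ ψ).1 q₀ :=
  congrArg Subtype.val (θ.apply_symm_apply _)

theorem IsIsotropyRep.toEquivariant_sectionAction (h : E.IsIsotropyRep q₀ τ θ) (g : G)
    (ψ : E.borelSections) : h.toEquivariant hl (E.sectionAction hl g ψ) =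
      leftTranslation S τ g (h.toEquivariant hl ψ) := by
  refine Subtype.ext (funext fun x => θ.injective (Subtype.ext ?_))
  change _ = (θ ((h.toEquivariant hl ψ).1 (g⁻¹ * x)) : K)
  rw [h.apply_toEquivariant, h.apply_toEquivariant, mul_inv_rev, inv_inv, map_mul]
  rfl

variable {s : M → G} (hs : ∀ q, l (s q) q₀ = q)

include hs

theorem IsIsotropyRep.inducedField_form_toEquivariant (h : E.IsIsotropyRep q₀ τ θ) (q : M)
    (ψ φ : E.borelSections) :
    (inducedField S τ).form (s q : G ⧸ S) (h.toEquivariant hl ψ) (h.toEquivariant hl φ) =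
      E.formField.form q ψ φ := by
  have h_inv : l (s q)⁻¹ q = q₀ := by
    rw [map_inv, Equiv.Perm.inv_eq_iff_eq, hs]
  have h_isometry := E.act_isometry (s q)⁻¹ q _ (ψ.2.2 q) _ (φ.2.2 q)
  rw [h_inv] at h_isometry
  rw [inducedField_form_mk, ← h.metric]
  simp only [h.apply_toEquivariant, sectionAction_inv_apply, hs]
  exact h_isometry

theorem IsIsotropyRep.toEquivariant_surjective (h : E.IsIsotropyRep q₀ τ θ) (hsm : Measurable s) :
    Surjective (h.toEquivariant hl) := fun f => by
  let ψ : E.borelSections := ⟨fun q => (E.act (s q) (q₀, θ (f.1 (s q)))).2,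
    E.measurable_act_snd hsm measurable_const (measurable_subtype_coe.comp
      ((LinearMap.continuous_of_finiteDimensional θ.toLinearMap).measurable.comp
        (f.2.1.comp hsm))) fun q => (θ _).2,
    fun q => by simpa only [hs] using E.act_snd_mem_fiber (s q) (θ (f.1 (s q))).2⟩
  refine ⟨ψ, Subtype.ext (funext fun g => θ.injective (Subtype.ext ?_))⟩
  set x := s (l g q₀)
  have hxg : l x q₀ = l g q₀ := hs _
  let k : S := ⟨g⁻¹ * x, (h.mem_iff _).2 (by rw [map_mul, Equiv.Perm.mul_apply, hxg]; simp)⟩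
  calc (θ ((h.toEquivariant hl ψ).1 g) : K)
      = (E.act g⁻¹ (l g q₀, (E.act x (q₀, θ (f.1 x))).2)).2 := by
        rw [h.apply_toEquivariant, sectionAction_inv_apply]
    _ = (E.act k (q₀, θ (f.1 x))).2 := by
        rw [← hxg, ← E.act_eq_mk x (θ (f.1 x)).2, ← E.act_mul _ _ _ (θ (f.1 x)).2]
    _ = θ (f.1 (x * (k⁻¹ : S))) := by rw [h.act, f.2.2, map_inv, inv_inv]
    _ = θ (f.1 g) := by simp [k]

theorem IsIsotropyRep.unitarilyEquivalent_ind (h : E.IsIsotropyRep q₀ τ θ) (hsm : Measurable s)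
    {μ : Measure M} (hμ : ∀ g, MeasurePreserving (l g) μ μ) {ι : M → G ⧸ S}
    (hιs : ∀ q, ι q = s q) {μ' : Measure (G ⧸ S)} (hι : MeasurePreserving ι μ μ')
    (hμ' : ∀ g, MeasurePreserving (MulAction.toPermHom G (G ⧸ S) g) μ' μ') :
    UnitarilyEquivalent (E.inducedRep μ hμ) (Ind S τ μ' hμ') := by
  have hl : ∀ g, Measurable (l g) := fun g => (hμ g).measurable
  have h_form : ∀ q ψ φ, (inducedField S τ).form (ι q) (h.toEquivariant hl ψ)
      (h.toEquivariant hl φ) = E.formField.form q ψ φ := fun q ψ φ => by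
    rw [hιs, h.inducedField_form_toEquivariant hl hs]
  have h_surj := h.toEquivariant_surjective hl hs hsm
  exact ⟨FormField.l2Equiv hι (h.toEquivariant hl) h_surj h_form,
    FormField.intertwines_l2Equiv hι h_surj h_form _ _ _ _ (h.toEquivariant_sectionAction hl)⟩

end HermitianGBundle

section SectionCocycle

variable {G M V : Type*} [Group G] {l : G →* Equiv.Perm M} {q₀ : M} {S : Subgroup G}
  (hS : ∀ g, g ∈ S ↔ l g q₀ = q₀) {s : M → G} (hs : ∀ q, l (s q) q₀ = q)

/-- The cocycle `s(gq)⁻¹ g s(q)` of a section `s` of the orbit map `g ↦ g q₀`, with values in the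
isotropy group `S` of `q₀`. -/
def sectionCocycle (g : G) (q : M) : S :=
  ⟨(s (l g q))⁻¹ * g * s q, by
    rw [hS, map_mul, map_mul, Equiv.Perm.mul_apply, Equiv.Perm.mul_apply, hs, map_inv,
      Equiv.Perm.inv_eq_iff_eq, hs]⟩

theorem sectionCocycle_one (q : M) : sectionCocycle hS hs 1 q = 1 :=
  Subtype.ext (by simp [sectionCocycle])

theorem sectionCocycle_mul (g g' : G) (q : M) : sectionCocycle hS hs (g * g') q =
    sectionCocycle hS hs g (l g' q) * sectionCocycle hS hs g' q :=
  Subtype.ext (by simp [sectionCocycle, mul_assoc])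

variable {EG EM K : Type*} [TopologicalSpace G] [NormedAddCommGroup EG] [NormedSpace ℝ EG]
  [ChartedSpace EG G] [LieGroup 𝓘(ℝ, EG) ∞ G] [TopologicalSpace M] [NormedAddCommGroup EM]
  [NormedSpace ℝ EM] [ChartedSpace EM M] [NormedAddCommGroup K] [InnerProductSpace ℂ K]
  {F : Submodule ℂ K} [F.HasOrthogonalProjection] {τ : S →* (F ≃ₗᵢ[ℂ] F)} {T : G → K →L[ℂ] K}

theorem isSmoothUnitaryCocycle_sectionCocycle
    (hl : ContMDiff (𝓘(ℝ, EG).prod 𝓘(ℝ, EM)) 𝓘(ℝ, EM) ∞ fun p : G × M => l p.1 p.2)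
    (hsm : ContMDiff 𝓘(ℝ, EM) 𝓘(ℝ, EG) ∞ s) (hT : ContMDiff 𝓘(ℝ, EG) 𝓘(ℝ, K →L[ℂ] K) ∞ T)
    (hτT : ∀ (k : S) (v : F), T k v = (τ k v : K)) :
    IsSmoothUnitaryCocycle EG EM l fun g q => τ (sectionCocycle hS hs g q) where
  one q := by rw [sectionCocycle_one, map_one]
  mul g g' q := by rw [sectionCocycle_mul, map_mul]
  smooth := by
    have h_eq : ∀ p : G × M, ((τ (sectionCocycle hS hs p.1 p.2)).toContinuousLinearEquiv :
        F →L[ℂ] F) = F.orthogonalProjectionOnto.comp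
          ((T ((s (l p.1 p.2))⁻¹ * p.1 * s p.2)).comp F.subtypeL) := fun p => by
      ext v
      exact congrArg Subtype.val ((congrArg F.orthogonalProjectionOnto (hτT _ v)).trans
        (F.orthogonalProjectionOnto_mem_subspace_eq_self _)).symm
    simp only [h_eq]
    exact contMDiff_complexLinear_comp contMDiff_const (contMDiff_complexLinear_comp (hT.comp
      (((hsm.comp hl).inv.mul contMDiff_fst).mul (hsm.comp contMDiff_snd))) contMDiff_const)

end SectionCocycle

section SemidirectProduct

variable {G : Type*} [Group G] [TopologicalSpace G] {N H : Subgroup G} [N.Normal]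
  (ν : PontryaginDual N) (e : N × H ≃ G) (he : ∀ n h, e (n, h) = (n : G) * h)

theorem baseAction_mul_mk (n : N) (h y : H) :
    baseAction ν e he ((n : G) * h) (y : H ⧸ littleGroup N H ν) =
      ((h * y : H) : H ⧸ littleGroup N H ν) := by
  change (((e.symm ((n : G) * h)).2 * y : H) : H ⧸ littleGroup N H ν) = _
  rw [symm_mul e he]

theorem baseAction_coe_mk (h y : H) :
    baseAction ν e he (h : G) (y : H ⧸ littleGroup N H ν) =
      ((h * y : H) : H ⧸ littleGroup N H ν) := by
  simpa using baseAction_mul_mk ν e he 1 h y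

theorem character_conjInv_eq_of_mk_eq {y y' : H}
    (h : (y : H ⧸ littleGroup N H ν) = y') (n : N) :
    ν (conjInv N (y : G) n) = ν (conjInv N (y' : G) n) := by
  have hk : y⁻¹ * y' ∈ littleGroup N H ν := QuotientGroup.eq.1 h
  rw [← hk (conjInv N (y : G) n), conjInv_conjInv]
  simp

variable {L : H ⧸ littleGroup N H ν → H} (hL : ∀ q, ((L q : H) : H ⧸ littleGroup N H ν) = q)

include hL in
theorem iota_eq_coe_section (q : H ⧸ littleGroup N H ν) :
    iota N H ν q = ((L q : G) : G ⧸ isotropy N ν) := by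
  rw [← iota_mk, hL]

include hL in
theorem baseAction_section (q : H ⧸ littleGroup N H ν) :
    baseAction ν e he (L q : G) ((1 : H) : H ⧸ littleGroup N H ν) = q := by
  rw [baseAction_coe_mk, mul_one, hL]

variable [IsMulCommutative N]

theorem mem_isotropy_iff_baseAction (g : G) :
    g ∈ isotropy N ν ↔ baseAction ν e he g ((1 : H) : H ⧸ littleGroup N H ν) = (1 : H) := by
  obtain ⟨⟨n, h⟩, rfl⟩ := e.surjective g
  rw [he, baseAction_mul_mk, mul_one, eq_comm, QuotientGroup.eq, inv_one, one_mul,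
    Subgroup.mul_mem_cancel_left _ (le_isotropy ν n.2)]
  rfl

theorem nuSigma_apply {V : Type*} [NormedAddCommGroup V] [InnerProductSpace ℂ V]
    (σ : littleGroup N H ν →* (V ≃ₗᵢ[ℂ] V)) {x : isotropy N ν} {n : N} {k : littleGroup N H ν}
    (hx : (x : G) = n * (k : H)) (v : V) : nuSigma ν e he σ x v = (ν n : ℂ) • σ k v := by
  have hs : e.symm (x : G) = (n, (k : H)) := by rw [hx, symm_mul e he]
  change ((ν (e.symm (x : G)).1 : Circle) : ℂ) • σ ⟨(e.symm (x : G)).2, _⟩ v = _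
  simp only [hs, Subtype.coe_eta]

theorem nuSigma_sectionCocycle {V : Type*} [NormedAddCommGroup V] [InnerProductSpace ℂ V]
    (σ : littleGroup N H ν →* (V ≃ₗᵢ[ℂ] V)) (n : N) (h y : H) (v : V) :
    nuSigma ν e he σ (sectionCocycle (mem_isotropy_iff_baseAction ν e he)
        (baseAction_section ν e he hL) ((n : G) * h) (y : H ⧸ littleGroup N H ν)) v =
      (ν (conjInv N ((h : G) * y) n) : ℂ) •
        σ (wigner L hL h (y : H ⧸ littleGroup N H ν)) v := by
  have h_phase := character_conjInv_eq_of_mk_eq ν (hL ((h * y : H) : H ⧸ littleGroup N H ν)) n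
  rw [Subgroup.coe_mul] at h_phase
  rw [← h_phase]
  refine nuSigma_apply ν e he σ ?_ v
  change (L (baseAction ν e he ((n : G) * h) (y : H ⧸ littleGroup N H ν)) : G)⁻¹ *
    ((n : G) * h) * L (y : H ⧸ littleGroup N H ν) = _
  rw [baseAction_mul_mk]
  change _ = ((L ((h * y : H) : H ⧸ littleGroup N H ν) : G)⁻¹ * n *
    L ((h * y : H) : H ⧸ littleGroup N H ν)) * ((L ((h * y : H) : H ⧸ littleGroup N H ν) : G)⁻¹ *
      h * L (y : H ⧸ littleGroup N H ν))
  group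

end SemidirectProduct

section SmoothSemidirect

theorem contMDiff_circle_coe : ContMDiff (𝓡 1) 𝓘(ℝ, ℂ) ∞ fun z : Circle => (z : ℂ) :=
  haveI : Fact (Module.finrank ℝ ℂ = 1 + 1) := Complex.finrank_real_complex_fact
  contMDiff_coe_sphere

variable {G EG EN EH EM : Type*} [Group G] [TopologicalSpace G]
  [NormedAddCommGroup EG] [NormedSpace ℝ EG] [ChartedSpace EG G]
  {N H : Subgroup G} [NormedAddCommGroup EN] [NormedSpace ℝ EN] [ChartedSpace EN N]
  [NormedAddCommGroup EH] [NormedSpace ℝ EH] [ChartedSpace EH H]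
  (e : Diffeomorph (𝓘(ℝ, EN).prod 𝓘(ℝ, EH)) 𝓘(ℝ, EG) (N × H) G ∞)
  (he : ∀ (n : N) (h : H), e (n, h) = (n : G) * h)

include he in
theorem contMDiff_coe_right : ContMDiff 𝓘(ℝ, EH) 𝓘(ℝ, EG) ∞ ((↑) : H → G) := by
  have h_eq : ((↑) : H → G) = fun h => e (1, h) := by simp [he]
  rw [h_eq]
  exact e.contMDiff.comp (contMDiff_const.prodMk contMDiff_id)

variable [N.Normal] {ν : PontryaginDual N}

theorem contMDiff_baseAction [LieGroup 𝓘(ℝ, EH) ∞ H]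
    [NormedAddCommGroup EM] [NormedSpace ℝ EM] [ChartedSpace EM (H ⧸ littleGroup N H ν)]
    (hπ : ContMDiff 𝓘(ℝ, EH) 𝓘(ℝ, EM) ∞ (QuotientGroup.mk : H → H ⧸ littleGroup N H ν))
    {L : H ⧸ littleGroup N H ν → H} (hL : ∀ q, ((L q : H) : H ⧸ littleGroup N H ν) = q)
    (hL' : ContMDiff 𝓘(ℝ, EM) 𝓘(ℝ, EH) ∞ L) :
    ContMDiff (𝓘(ℝ, EG).prod 𝓘(ℝ, EM)) 𝓘(ℝ, EM) ∞
      fun p : G × (H ⧸ littleGroup N H ν) => baseAction ν e.toEquiv he p.1 p.2 := by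
  have h_eq : (fun p : G × (H ⧸ littleGroup N H ν) => baseAction ν e.toEquiv he p.1 p.2) =
      fun p => (((e.symm p.1).2 * L p.2 : H) : H ⧸ littleGroup N H ν) := funext fun p =>
    congrArg (baseAction ν e.toEquiv he p.1) (hL p.2).symm
  rw [h_eq]
  exact hπ.comp ((contMDiff_snd.comp (e.symm.contMDiff.comp contMDiff_fst)).mul
    (hL'.comp contMDiff_snd))

end SmoothSemidirect

section Bundles

variable {G EG EN EH EM K : Type*} [Group G] [TopologicalSpace G]
  [NormedAddCommGroup EG] [NormedSpace ℝ EG] [ChartedSpace EG G]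
  {N H : Subgroup G} [NormedAddCommGroup EN] [NormedSpace ℝ EN] [ChartedSpace EN N]
  [NormedAddCommGroup EH] [NormedSpace ℝ EH] [ChartedSpace EH H]
  [NormedAddCommGroup K] [InnerProductSpace ℂ K]
  (e : Diffeomorph (𝓘(ℝ, EN).prod 𝓘(ℝ, EH)) 𝓘(ℝ, EG) (N × H) G ∞)
  (he : ∀ (n : N) (h : H), e (n, h) = (n : G) * h) {ν : PontryaginDual N}
  {Φ : H →* (K ≃L[ℂ] K)}

section Extension

variable (ν Φ)

/-- The smooth extension `nh ↦ ν(n) Φ(h)` of the representation `νσ` from `G_ν` to all of `G`. It is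
in general not multiplicative. -/
def nuPhi (x : G) : K →L[ℂ] K := (ν (e.symm x).1 : ℂ) • (Φ (e.symm x).2 : K →L[ℂ] K)

variable {ν Φ}

theorem contMDiff_nuPhi (hν : ContMDiff 𝓘(ℝ, EN) (𝓡 1) ∞ ν)
    (hΦ : ContMDiff 𝓘(ℝ, EH) 𝓘(ℝ, K →L[ℂ] K) ∞ fun h => (Φ h : K →L[ℂ] K)) :
    ContMDiff 𝓘(ℝ, EG) 𝓘(ℝ, K →L[ℂ] K) ∞ (nuPhi e ν Φ) :=
  have h_smul : ContDiff ℝ ∞ fun p : ℂ × (K →L[ℂ] K) => p.1 • p.2 := contDiff_smul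
  h_smul.contMDiff.comp ((contMDiff_circle_coe.comp
    (hν.comp (contMDiff_fst.comp e.symm.contMDiff))).prodMk_space
      (hΦ.comp (contMDiff_snd.comp e.symm.contMDiff)))

end Extension

variable [N.Normal] {Hσ : Submodule ℂ K} {σ : littleGroup N H ν →* (Hσ ≃ₗᵢ[ℂ] Hσ)}
  (hσΦ : ∀ (k : littleGroup N H ν) (v : Hσ), Φ (k : H) (v : K) = (σ k v : K))
  {L : H ⧸ littleGroup N H ν → H} (hL : ∀ q, ((L q : H) : H ⧸ littleGroup N H ν) = q)

include hσΦ hL in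
theorem symm_apply_section (x : H) (v : Hσ) :
    (Φ x).symm (Φ (L (x : H ⧸ littleGroup N H ν)) v) =
      (σ ⟨x⁻¹ * L (x : H ⧸ littleGroup N H ν), QuotientGroup.eq.1 (hL _).symm⟩ v : K) := by
  rw [← hσΦ, map_mul, map_inv]
  rfl

include hσΦ in
theorem section_apply_wigner (h y : H) (v : Hσ) :
    Φ (L ((h * y : H) : H ⧸ littleGroup N H ν))
        (σ (wigner L hL h (y : H ⧸ littleGroup N H ν)) v : K) =
      Φ h (Φ (L (y : H ⧸ littleGroup N H ν)) v) := by
  have h_wigner : L ((h * y : H) : H ⧸ littleGroup N H ν) *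
      ((wigner L hL h (y : H ⧸ littleGroup N H ν) : littleGroup N H ν) : H) =
        h * L (y : H ⧸ littleGroup N H ν) := by
    simp [wigner, mul_assoc]
  rw [← hσΦ]
  exact congrArg (fun T : K ≃L[ℂ] K => T v)
    ((map_mul Φ _ _).symm.trans ((congrArg Φ h_wigner).trans (map_mul Φ _ _)))

variable [IsMulCommutative N]

include hσΦ in
theorem nuPhi_coe (x : isotropy N ν) (v : Hσ) :
    nuPhi e ν Φ x v = (nuSigma ν e.toEquiv he σ x v : K) :=
  congrArg ((ν (e.symm (x : G)).1 : ℂ) • ·) (hσΦ ⟨_, projH_mem ν e.toEquiv he x.2⟩ v)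

variable [LieGroup 𝓘(ℝ, EG) ∞ G] [LieGroup 𝓘(ℝ, EH) ∞ H] [FiniteDimensional ℂ K]
  [NormedAddCommGroup EM] [NormedSpace ℝ EM] [ChartedSpace EM (H ⧸ littleGroup N H ν)]
  (hν : ContMDiff 𝓘(ℝ, EN) (𝓡 1) ∞ ν)
  (hπ : ContMDiff 𝓘(ℝ, EH) 𝓘(ℝ, EM) ∞ (QuotientGroup.mk : H → H ⧸ littleGroup N H ν))
  (hΦ : ContMDiff 𝓘(ℝ, EH) 𝓘(ℝ, K →L[ℂ] K) ∞ fun h => (Φ h : K →L[ℂ] K))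
  (hL' : ContMDiff 𝓘(ℝ, EM) 𝓘(ℝ, EH) ∞ L)

/-- The boosting bundle `E_{L,σ}`: the product bundle on which `G` acts by the values of `νσ` on the
cocycle of the section `L`. -/
def boostingBundle : HermitianGBundle EG EM (baseAction ν e.toEquiv he) Hσ :=
  HermitianGBundle.product (contMDiff_baseAction e he hπ hL hL')
    (isSmoothUnitaryCocycle_sectionCocycle (mem_isotropy_iff_baseAction ν e.toEquiv he)
      (baseAction_section ν e.toEquiv he hL) (contMDiff_baseAction e he hπ hL hL')
      ((contMDiff_coe_right e he).comp hL') (contMDiff_nuPhi e hν hΦ) (nuPhi_coe e he hσΦ))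

/-- The perception bundle `E_σ`: the image of the boosting bundle under `(q, v) ↦ (q, Φ(L(q)) v)`,
whose inverse is `(q, w) ↦ (q, Φ(L(q))⁻¹ w)`, extended to `K` by the orthogonal projection. -/
def perceptionBundle : HermitianGBundle EG EM (baseAction ν e.toEquiv he) K :=
  (boostingBundle e he hσΦ hL hν hπ hΦ hL').pushforward
    (a := fun q => (Φ (L q) : K →L[ℂ] K).comp Hσ.subtypeL)
    (b := fun q => Hσ.orthogonalProjectionOnto.comp (Φ (L q)⁻¹ : K →L[ℂ] K))
    (contMDiff_complexLinear_comp (hΦ.comp hL') contMDiff_const)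
    (contMDiff_complexLinear_comp contMDiff_const (hΦ.comp hL'.inv))
    fun q v => by
      rw [map_inv]
      exact (congrArg Hσ.orthogonalProjectionOnto ((Φ (L q)).symm_apply_apply v)).trans
        (Hσ.orthogonalProjectionOnto_mem_subspace_eq_self v)

theorem boostingBundle_act (n : N) (h y : H) (v : Hσ) :
    (boostingBundle e he hσΦ hL hν hπ hΦ hL').act ((n : G) * h)
        ((y : H ⧸ littleGroup N H ν), v) =
      (((h * y : H) : H ⧸ littleGroup N H ν), (ν (conjInv N ((h : G) * y) n) : ℂ) •
        σ (wigner L hL h (y : H ⧸ littleGroup N H ν)) v) :=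
  Prod.ext (baseAction_mul_mk ν e.toEquiv he n h y)
    (nuSigma_sectionCocycle ν e.toEquiv he hL σ n h y v)

theorem isIso_boostingBundle_perceptionBundle :
    (boostingBundle e he hσΦ hL hν hπ hΦ hL').IsIso (perceptionBundle e he hσΦ hL hν hπ hΦ hL')
      fun p => (p.1, Φ (L p.1) p.2) :=
  HermitianGBundle.isIso_pushforward _ _ _ _

variable {e he hσΦ hL hν hπ hΦ hL'} in
theorem mem_perceptionBundle_fiber {q : H ⧸ littleGroup N H ν} {w : K} :
    w ∈ (perceptionBundle e he hσΦ hL hν hπ hΦ hL').fiber q ↔ ∃ v : Hσ, Φ (L q) v = w :=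
  Submodule.mem_map.trans ⟨fun ⟨v, _, hv⟩ => ⟨v, hv⟩, fun ⟨v, hv⟩ => ⟨v, trivial, hv⟩⟩

theorem perceptionBundle_total : (perceptionBundle e he hσΦ hL hν hπ hΦ hL').total =
    range fun p : (H ⧸ littleGroup N H ν) × Hσ => (p.1, Φ (L p.1) p.2) := by
  ext ⟨q, w⟩
  refine mem_perceptionBundle_fiber.trans ⟨fun ⟨v, hv⟩ => ⟨(q, v), Prod.ext rfl hv⟩, ?_⟩
  rintro ⟨⟨q, v⟩, rfl, rfl⟩
  exact ⟨v, rfl⟩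

theorem perceptionBundle_metric (x : H) {v w : K}
    (hv : v ∈ (perceptionBundle e he hσΦ hL hν hπ hΦ hL').fiber (x : H ⧸ littleGroup N H ν))
    (hw : w ∈ (perceptionBundle e he hσΦ hL hν hπ hΦ hL').fiber (x : H ⧸ littleGroup N H ν)) :
    (perceptionBundle e he hσΦ hL hν hπ hΦ hL').metric (x : H ⧸ littleGroup N H ν) v w =
      inner ℂ ((Φ x).symm v) ((Φ x).symm w) := by
  obtain ⟨v, rfl⟩ := mem_perceptionBundle_fiber.1 hv
  obtain ⟨w, rfl⟩ := mem_perceptionBundle_fiber.1 hw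
  rw [symm_apply_section hσΦ hL, symm_apply_section hσΦ hL, ← Submodule.coe_inner,
    LinearIsometryEquiv.inner_map_map]
  exact (isIso_boostingBundle_perceptionBundle e he hσΦ hL hν hπ hΦ hL').1.isometry
    x v trivial w trivial

theorem perceptionBundle_act (n : N) (h y : H) {v : K}
    (hv : v ∈ (perceptionBundle e he hσΦ hL hν hπ hΦ hL').fiber (y : H ⧸ littleGroup N H ν)) :
    (perceptionBundle e he hσΦ hL hν hπ hΦ hL').act ((n : G) * h)
        ((y : H ⧸ littleGroup N H ν), v) =
      (((h * y : H) : H ⧸ littleGroup N H ν), (ν (conjInv N ((h : G) * y) n) : ℂ) • Φ h v) := by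
  obtain ⟨v, rfl⟩ := mem_perceptionBundle_fiber.1 hv
  have h_equivariant :=
    (isIso_boostingBundle_perceptionBundle e he hσΦ hL hν hπ hΦ hL').1.equivariant
      ((n : G) * h) ((y : H ⧸ littleGroup N H ν), v) trivial
  rw [← h_equivariant, boostingBundle_act]
  refine Prod.ext rfl ?_
  rw [← section_apply_wigner hσΦ hL]
  exact map_smul (Φ (L ((h * y : H) : H ⧸ littleGroup N H ν))) _ _

theorem perceptionBundle_fiber_one :
    (perceptionBundle e he hσΦ hL hν hπ hΦ hL').fiber ((1 : H) : H ⧸ littleGroup N H ν) = Hσ := by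
  have h_section : ∀ v : Hσ, Φ (L ((1 : H) : H ⧸ littleGroup N H ν)) v =
      (σ ⟨1⁻¹ * L ((1 : H) : H ⧸ littleGroup N H ν), QuotientGroup.eq.1 (hL _).symm⟩ v : K) :=
    fun v => by
      rw [← symm_apply_section hσΦ hL, map_one]
      rfl
  ext w
  simp only [mem_perceptionBundle_fiber, h_section]
  exact ⟨fun ⟨v, hv⟩ => hv ▸ Subtype.property _,
    fun hw => ⟨(σ _).symm ⟨w, hw⟩, by rw [LinearIsometryEquiv.apply_symm_apply]⟩⟩

theorem isIsotropyRep_perceptionBundle :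
    (perceptionBundle e he hσΦ hL hν hπ hΦ hL').IsIsotropyRep ((1 : H) : H ⧸ littleGroup N H ν)
      (nuSigma ν e.toEquiv he σ)
      (LinearEquiv.ofEq _ _ (perceptionBundle_fiber_one e he hσΦ hL hν hπ hΦ hL').symm) where
  mem_iff := mem_isotropy_iff_baseAction ν e.toEquiv he
  metric v w := by
    rw [perceptionBundle_metric e he hσΦ hL hν hπ hΦ hL' 1 (Subtype.property _)
      (Subtype.property _), map_one]
    rfl
  act k v := by
    let E := perceptionBundle e he hσΦ hL hν hπ hΦ hL'
    have hv : (v : K) ∈ E.fiber ((1 : H) : H ⧸ littleGroup N H ν) :=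
      (perceptionBundle_fiber_one e he hσΦ hL hν hπ hΦ hL').symm ▸ v.2
    have h_phase : ν (conjInv N ((e.symm (k : G)).2 : G) (e.symm (k : G)).1) =
        ν (e.symm (k : G)).1 := projH_mem ν e.toEquiv he k.2 _
    calc (E.act (k : G) (((1 : H) : H ⧸ littleGroup N H ν), (v : K))).2
        = (ν (conjInv N (((e.symm (k : G)).2 : G) * (1 : H)) (e.symm (k : G)).1) : ℂ) •
            Φ (e.symm (k : G)).2 v := by
          conv_lhs => rw [semidirect_eq e.toEquiv he k]
          exact congrArg Prod.snd (perceptionBundle_act e he hσΦ hL hν hπ hΦ hL' _ _ 1 hv)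
      _ = nuPhi e ν Φ k v := by
          rw [Subgroup.coe_one, mul_one, h_phase]
          rfl
      _ = (nuSigma ν e.toEquiv he σ k v : K) := nuPhi_coe e he hσΦ k v

end Bundles

section QuotientTopology

variable {H : Type*} [Group H] [TopologicalSpace H] {S : Subgroup H} {L : H ⧸ S → H}
  (hL : ∀ q, ((L q : H) : H ⧸ S) = q) (hLc : Continuous L)

include hL hLc

theorem t2Space_quotient_of_section [T2Space H] : T2Space (H ⧸ S) :=
  T2Space.of_injective_continuous (LeftInverse.injective (g := QuotientGroup.mk) hL) hLc

theorem borelSpace_quotient_of_section [MeasurableSpace H] [BorelSpace H] :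
    BorelSpace (H ⧸ S) := by
  refine ⟨le_antisymm (fun s hs => ?_) OpensMeasurableSpace.borel_le⟩
  have h_preimage : L ⁻¹' (QuotientGroup.mk ⁻¹' s) = s := by
    ext q
    rw [mem_preimage, mem_preimage, hL]
  have h_measurable : Measurable[borel (H ⧸ S)] L :=
    letI := borel (H ⧸ S)
    haveI : BorelSpace (H ⧸ S) := ⟨rfl⟩
    hLc.measurable
  exact h_preimage ▸ h_measurable (QuotientGroup.measurable_coe hs)

end QuotientTopology

section InducedRepresentations

variable {G EG EN EH EM K : Type*} [Group G] [TopologicalSpace G] [SecondCountableTopology G]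
  [IsTopologicalGroup G] [MeasurableSpace G] [BorelSpace G]
  [NormedAddCommGroup EG] [NormedSpace ℝ EG] [ChartedSpace EG G] [LieGroup 𝓘(ℝ, EG) ∞ G]
  {N H : Subgroup G} [N.Normal] [IsMulCommutative N]
  [NormedAddCommGroup EN] [NormedSpace ℝ EN] [ChartedSpace EN N]
  [NormedAddCommGroup EH] [NormedSpace ℝ EH] [ChartedSpace EH H] [LieGroup 𝓘(ℝ, EH) ∞ H]
  [NormedAddCommGroup K] [InnerProductSpace ℂ K] [FiniteDimensional ℂ K]
  [MeasurableSpace K] [BorelSpace K]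
  (e : Diffeomorph (𝓘(ℝ, EN).prod 𝓘(ℝ, EH)) 𝓘(ℝ, EG) (N × H) G ∞)
  (he : ∀ (n : N) (h : H), e (n, h) = (n : G) * h) {ν : PontryaginDual N}
  {Φ : H →* (K ≃L[ℂ] K)} {Hσ : Submodule ℂ K} {σ : littleGroup N H ν →* (Hσ ≃ₗᵢ[ℂ] Hσ)}
  (hσΦ : ∀ (k : littleGroup N H ν) (v : Hσ), Φ (k : H) (v : K) = (σ k v : K))
  {L : H ⧸ littleGroup N H ν → H} (hL : ∀ q, ((L q : H) : H ⧸ littleGroup N H ν) = q)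
  [NormedAddCommGroup EM] [NormedSpace ℝ EM] [ChartedSpace EM (H ⧸ littleGroup N H ν)]
  (hν : ContMDiff 𝓘(ℝ, EN) (𝓡 1) ∞ ν)
  (hπ : ContMDiff 𝓘(ℝ, EH) 𝓘(ℝ, EM) ∞ (QuotientGroup.mk : H → H ⧸ littleGroup N H ν))
  (hΦ : ContMDiff 𝓘(ℝ, EH) 𝓘(ℝ, K →L[ℂ] K) ∞ fun h => (Φ h : K →L[ℂ] K))
  (hL' : ContMDiff 𝓘(ℝ, EM) 𝓘(ℝ, EH) ∞ L)
  (μ : Measure (H ⧸ littleGroup N H ν)) [SMulInvariantMeasure H (H ⧸ littleGroup N H ν) μ]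

theorem isUnitaryRepresentation_boostingBundle [T2Space G]
    [FiniteDimensional ℝ EG] [FiniteDimensional ℝ EM] [IsFiniteMeasureOnCompacts μ] :
    IsUnitaryRepresentation ((boostingBundle e he hσΦ hL hν hπ hΦ hL').inducedRep μ
      (measurePreserving_baseAction ν e.toEquiv he μ)) := by
  have := t2Space_quotient_of_section hL hL'.continuous
  have := borelSpace_quotient_of_section hL hL'.continuous
  have : SecondCountableTopology H := TopologicalSpace.Subtype.secondCountableTopology (H : Set G)
  have : LocallyCompactSpace G := Manifold.locallyCompact_of_finiteDimensional 𝓘(ℝ, EG)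
  have : LocallyCompactSpace (H ⧸ littleGroup N H ν) :=
    Manifold.locallyCompact_of_finiteDimensional 𝓘(ℝ, EM)
  exact HermitianGBundle.isUnitaryRepresentation_product _

theorem unitarilyEquivalent_perceptionBundle_ind :
    UnitarilyEquivalent
      ((perceptionBundle e he hσΦ hL hν hπ hΦ hL').inducedRep μ
        (measurePreserving_baseAction ν e.toEquiv he μ))
      (Ind (isotropy N ν) (nuSigma ν e.toEquiv he σ) (μ.map (iota N H ν))
        (measurePreserving_map_iota ν e.toEquiv he μ)) :=
  haveI := borelSpace_quotient_of_section hL hL'.continuous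
  (isIsotropyRep_perceptionBundle e he hσΦ hL hν hπ hΦ hL').unitarilyEquivalent_ind
    (s := fun q => (L q : G)) (baseAction_section ν e.toEquiv he hL)
    (continuous_subtype_val.comp hL'.continuous).measurable _ (iota_eq_coe_section ν hL)
    ⟨measurable_iota ν, rfl⟩ _

end InducedRepresentations

end Perception

end

theorem theorem7p1
    {G EG EN EH EM K : Type*}
    -- the Lie group `G`
    [Group G] [TopologicalSpace G] [T2Space G] [SecondCountableTopology G]
    [NormedAddCommGroup EG] [NormedSpace ℝ EG] [FiniteDimensional ℝ EG] [ChartedSpace EG G]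
    [IsTopologicalGroup G] [LieGroup 𝓘(ℝ, EG) ∞ G] [MeasurableSpace G] [BorelSpace G]
    -- Lie subgroups `N` (normal and abelian) and `H` such that `N × H → G` is a diffeomorphism
    (N H : Subgroup G) [N.Normal] [IsMulCommutative N]
    [NormedAddCommGroup EN] [NormedSpace ℝ EN] [FiniteDimensional ℝ EN] [ChartedSpace EN N]
    [LieGroup 𝓘(ℝ, EN) ∞ N]
    [NormedAddCommGroup EH] [NormedSpace ℝ EH] [FiniteDimensional ℝ EH] [ChartedSpace EH H]
    [LieGroup 𝓘(ℝ, EH) ∞ H]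
    (e : Diffeomorph (𝓘(ℝ, EN).prod 𝓘(ℝ, EH)) 𝓘(ℝ, EG) (N × H) G ∞)
    (he : ∀ (n : N) (h : H), e (n, h) = (n : G) * h)
    -- the character `ν`
    (ν : PontryaginDual N) (hν : ContMDiff 𝓘(ℝ, EN) (𝓡 1) ∞ ν)
    -- the quotient manifold `H/H_ν`, with the smooth structure for which `H → H/H_ν` is a submersion
    [NormedAddCommGroup EM] [NormedSpace ℝ EM] [FiniteDimensional ℝ EM]
    [ChartedSpace EM (H ⧸ Perception.littleGroup N H ν)]
    [IsManifold 𝓘(ℝ, EM) ∞ (H ⧸ Perception.littleGroup N H ν)]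
    (hπ : Manifold.IsSubmersion 𝓘(ℝ, EH) 𝓘(ℝ, EM) ∞
      (QuotientGroup.mk : H → H ⧸ Perception.littleGroup N H ν))
    -- the Hilbert space `K_Φ`, its subspace `H_σ`, and the representations `σ` and `Φ`
    [NormedAddCommGroup K] [InnerProductSpace ℂ K] [FiniteDimensional ℂ K] [CompleteSpace K]
    [MeasurableSpace K] [BorelSpace K]
    (Hσ : Submodule ℂ K) (σ : Perception.littleGroup N H ν →* (Hσ ≃ₗᵢ[ℂ] Hσ))
    (Φ : H →* (K ≃L[ℂ] K))
    (hΦ : ContMDiff 𝓘(ℝ, EH) 𝓘(ℝ, K →L[ℂ] K) ∞ fun h => (Φ h : K →L[ℂ] K))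
    (hσΦ : ∀ (k : Perception.littleGroup N H ν) (v : Hσ), Φ (k : H) (v : K) = (σ k v : K))
    -- the global section `L` and the invariant measure `μ`
    (L : H ⧸ Perception.littleGroup N H ν → H)
    (hL : ∀ q, ((L q : H) : H ⧸ Perception.littleGroup N H ν) = q)
    (hL' : ContMDiff 𝓘(ℝ, EM) 𝓘(ℝ, EH) ∞ L)
    (μ : Measure (H ⧸ Perception.littleGroup N H ν)) [IsFiniteMeasureOnCompacts μ]
    [SMulInvariantMeasure H (H ⧸ Perception.littleGroup N H ν) μ] :
    ∃ (E : Perception.HermitianGBundle EG EM (Perception.baseAction ν e.toEquiv he) K)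
      (EL : Perception.HermitianGBundle EG EM (Perception.baseAction ν e.toEquiv he) Hσ),
      let A : (H ⧸ Perception.littleGroup N H ν) × Hσ → (H ⧸ Perception.littleGroup N H ν) × K :=
        fun p => (p.1, Φ (L p.1) p.2)
      let U := E.inducedRep μ (Perception.measurePreserving_baseAction ν e.toEquiv he μ)
      let UL := EL.inducedRep μ (Perception.measurePreserving_baseAction ν e.toEquiv he μ)
      let Indνσ := Perception.Ind (Perception.isotropy N ν) (Perception.nuSigma ν e.toEquiv he σ)
        (μ.map (Perception.iota N H ν))
        (Perception.measurePreserving_map_iota ν e.toEquiv he μ)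
      -- the boosting bundle: bundle, metric and action
      (∀ q, EL.fiber q = ⊤) ∧
      (∀ q v w, EL.metric q v w = inner ℂ v w) ∧
      (∀ (n : N) (h y : H) (v : Hσ),
        EL.act ((n : G) * h) ((y : H ⧸ Perception.littleGroup N H ν), v) =
          (((h * y : H) : H ⧸ Perception.littleGroup N H ν),
            ((ν (Perception.conjInv N ((h : G) * y) n) : Circle) : ℂ) •
              σ (Perception.wigner L hL h (y : H ⧸ Perception.littleGroup N H ν)) v)) ∧
      -- the perception bundle: bundle, metric and action
      E.total = range A ∧
      (∀ (x : H), ∀ v ∈ E.fiber (x : H ⧸ Perception.littleGroup N H ν),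
        ∀ w ∈ E.fiber (x : H ⧸ Perception.littleGroup N H ν),
        E.metric (x : H ⧸ Perception.littleGroup N H ν) v w =
          inner ℂ v (ContinuousLinearMap.adjoint ((Φ x).symm : K →L[ℂ] K) ((Φ x).symm w))) ∧
      (∀ (n : N) (h y : H), ∀ v ∈ E.fiber (y : H ⧸ Perception.littleGroup N H ν),
        E.act ((n : G) * h) ((y : H ⧸ Perception.littleGroup N H ν), v) =
          (((h * y : H) : H ⧸ Perception.littleGroup N H ν),
            ((ν (Perception.conjInv N ((h : G) * y) n) : Circle) : ℂ) • Φ h v)) ∧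
      -- the map is an isomorphism of Hermitian `G`-bundles onto the perception bundle
      EL.IsIso E A ∧
      -- the three unitary representations and their equivalence
      Perception.IsUnitaryRepresentation U ∧ Perception.IsUnitaryRepresentation UL ∧
      Perception.IsUnitaryRepresentation Indνσ ∧
      Perception.UnitarilyEquivalent Indνσ U ∧ Perception.UnitarilyEquivalent U UL ∧
      -- composition with the bundle isomorphism intertwines `UL` and `U`
      (∃ T : EL.L2 μ ≃ₗᵢ[ℂ] E.L2 μ, Perception.Intertwines UL U T ∧
        ∀ ψ : EL.PreL2 μ, ∃ φ : E.PreL2 μ,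
          (∀ q, (q, Perception.HermitianGBundle.sec φ q) =
            A (q, Perception.HermitianGBundle.sec ψ q)) ∧
          T (Perception.HermitianGBundle.cls ψ) = Perception.HermitianGBundle.cls φ) ∧
      -- the boosting space is `L²(H/H_ν; μ) ⊗ H_σ`
      ∃ T : (Lp ℂ 2 μ) ⊗[ℂ] Hσ ≃ₗᵢ[ℂ] EL.L2 μ,
        ∀ (f : Lp ℂ 2 μ) (v : Hσ), ∃ ψ : EL.PreL2 μ,
          (∀ᵐ q ∂μ, Perception.HermitianGBundle.sec ψ q = f q • v) ∧
          T (f ⊗ₜ[ℂ] v) = Perception.HermitianGBundle.cls ψ := by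
  have hA := Perception.isIso_boostingBundle_perceptionBundle e he hσΦ hL hν hπ.contMDiff hΦ hL'
  have hT := hA.exists_intertwines μ (Perception.measurePreserving_baseAction ν e.toEquiv he μ)
  have hUL_U : Perception.UnitarilyEquivalent _ _ := hT.imp fun _ hT => hT.1
  have hU_Ind :=
    Perception.unitarilyEquivalent_perceptionBundle_ind e he hσΦ hL hν hπ.contMDiff hΦ hL' μ
  have hUL :=
    Perception.isUnitaryRepresentation_boostingBundle e he hσΦ hL hν hπ.contMDiff hΦ hL' μ
  have hU := hUL_U.isUnitaryRepresentation hUL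
  refine ⟨_, _, fun _ => rfl, fun _ _ _ => rfl, Perception.boostingBundle_act e he hσΦ hL _ _ _ _,
    Perception.perceptionBundle_total .., fun x v hv w hw => ?_, fun n h y v hv => ?_,
    hA, hU, hUL, hU_Ind.isUnitaryRepresentation hU, hU_Ind.symm, hUL_U.symm, hT,
    Perception.HermitianGBundle.exists_tensor_equiv _ _ μ⟩
  · rw [ContinuousLinearMap.adjoint_inner_right]
    exact Perception.perceptionBundle_metric _ _ _ _ _ _ _ _ x hv hw
  · exact Perception.perceptionBundle_act _ _ _ _ _ _ _ _ n h y hv
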